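/- For $q\in(1,2)$ and $x\in[0,\frac1{q-1}]$, a $q$-expansion of $x$ is a sequence $(\delta_i)_{i\ge1}\in\{0,1\}^{\mathbb N}$ with $x=\sum_{i=1}^\infty \delta_i q^{-i}$; let $\Sigma_q(x)$ be the set of all $q$-expansions of $x$. Let $\mathcal{B}_{\aleph_0}$ be the set of all $q\in[\frac{1+\sqrt5}{2},2)$ for which there is an $x\in[0,\frac1{q-1}]$ such that $\Sigma_q(x)$ has cardinality exactly $\aleph_0$. Let $q_1\approx1.64541$ be the unique positive root of $x^6-x^4-x^3-2x^2-x-1$, let $q_2\approx1.65462$ be the unique positive root of $x^6-2x^4-x^3-1$, and let $q_3\approx1.68042$ be the unique root greater than $1$ of $x^5-x^4-x^3-x+1$ (each approximation with error less than $10^{-5}$). Then $$\mathcal{B}_{\aleph_0}\cap\Bigl(\tfrac{1+\sqrt5}{2},\,q_3\Bigr]=\{q_1,q_2,q_3\}.$$ -/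

import Mathlib

namespace QExpansion

/-- The set `Σ_q(x)` of `q`-expansions of `x`: the digit sequences `δ₁ δ₂ δ₃ …` in `{0, 1}` with
`x = ∑_{i ≥ 1} δ_i / q ^ i`. The digit `δ_{i+1}` is stored as `δ i`. -/
def expansions (q x : ℝ) : Set (ℕ → Fin 2) :=
  {δ | HasSum (fun i : ℕ => ((δ i : ℕ) : ℝ) / q ^ (i + 1)) x}

/-- The set `𝓑_m` of bases `q ∈ [(1 + √5) / 2, 2)` for which some `x ∈ [0, 1 / (q - 1)]` has
exactly `m` different `q`-expansions. -/
def basesWith (m : Cardinal.{0}) : Set ℝ :=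
  {q | q ∈ Set.Ico ((1 + Real.sqrt 5) / 2) 2 ∧
    ∃ x ∈ Set.Icc (0 : ℝ) (1 / (q - 1)), Cardinal.mk (expansions q x) = m}

end QExpansion

namespace QExpansion

open Filter Topology

/-- The orbit of `x` under the maps `y ↦ q * y - b`, where the digits `b` are read off from `δ`. -/
def orb (q x : ℝ) (δ : ℕ → Fin 2) : ℕ → ℝ
  | 0 => x
  | n + 1 => q * orb q x δ n - ((δ n : ℕ) : ℝ)

/-- Prepend a digit. -/
def cons (b : Fin 2) (δ : ℕ → Fin 2) : ℕ → Fin 2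
  | 0 => b
  | n + 1 => δ n

@[simp] lemma orb_zero (q x : ℝ) (δ : ℕ → Fin 2) : orb q x δ 0 = x := rfl

lemma orb_succ (q x : ℝ) (δ : ℕ → Fin 2) (n : ℕ) :
    orb q x δ (n + 1) = q * orb q x δ n - ((δ n : ℕ) : ℝ) := rfl

lemma orb_add (q x : ℝ) (δ : ℕ → Fin 2) (n m : ℕ) :
    orb q x δ (n + m) = orb q (orb q x δ n) (fun i => δ (n + i)) m := by
  induction m with
  | zero => rfl
  | succ m ih => rw [← add_assoc, orb_succ, ih, orb_succ]

lemma orb_congr (q x : ℝ) {δ η : ℕ → Fin 2} {n : ℕ} (h : ∀ i < n, δ i = η i) :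
    orb q x δ n = orb q x η n := by
  induction n with
  | zero => rfl
  | succ n ih => rw [orb_succ, orb_succ, ih fun i hi => h i (by omega), h n (by omega)]

lemma orb_cons (q x : ℝ) (b : Fin 2) (δ : ℕ → Fin 2) (n : ℕ) :
    orb q x (cons b δ) (n + 1) = orb q (q * x - ((b : ℕ) : ℝ)) δ n := by
  rw [add_comm, orb_add]
  congr 1
  funext i
  rw [add_comm]; rfl

lemma digit_cases (b : Fin 2) : b = 0 ∨ b = 1 := by omega

lemma digit_nonneg (b : Fin 2) : (0 : ℝ) ≤ ((b : ℕ) : ℝ) := by positivity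

lemma digit_le_one (b : Fin 2) : ((b : ℕ) : ℝ) ≤ 1 := by
  have : (b : ℕ) ≤ 1 := by omega
  exact_mod_cast this

lemma hasSum_of_eq {f g : ℕ → ℝ} {a : ℝ} (h : HasSum f a) (hfg : ∀ i, g i = f i) :
    HasSum g a := by
  rwa [funext hfg]

lemma sub_partial_sum {q : ℝ} (hq : 1 < q) (x : ℝ) (δ : ℕ → Fin 2) (n : ℕ) :
    x - ∑ i ∈ Finset.range n, ((δ i : ℕ) : ℝ) / q ^ (i + 1) = orb q x δ n / q ^ n := by
  have : q ≠ 0 := by positivity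
  induction n with
  | zero => simp
  | succ n ih =>
    rw [Finset.sum_range_succ, ← sub_sub, ih, orb_succ]
    field_simp
    ring

lemma mem_Icc_of_mem_expansions {q x : ℝ} (hq : 1 < q) {δ : ℕ → Fin 2}
    (h : δ ∈ expansions q x) : x ∈ Set.Icc 0 (1 / (q - 1)) := by
  have h' : HasSum (fun i : ℕ => ((δ i : ℕ) : ℝ) / q ^ (i + 1)) x := h
  have hq0 : 0 < q := by linarith
  have hg : HasSum (fun i : ℕ => 1 / q ^ (i + 1)) (1 / (q - 1)) := by
    have := (hasSum_geometric_of_lt_one (inv_nonneg.2 hq0.le) (inv_lt_one_of_one_lt₀ hq)).mul_left q⁻¹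
    have h1 : q⁻¹ * (1 - q⁻¹)⁻¹ = 1 / (q - 1) := by
      rw [← mul_inv, mul_sub, mul_inv_cancel₀ hq0.ne', mul_one, one_div]
    rw [h1] at this
    refine hasSum_of_eq this fun i => ?_
    rw [pow_succ, inv_pow]; field_simp
  refine ⟨h'.nonneg fun i => by positivity, hasSum_le (fun i => ?_) h' hg⟩
  have := digit_le_one (δ i)
  gcongr

lemma mem_expansions_iff {q : ℝ} (hq : 1 < q) (x : ℝ) (δ : ℕ → Fin 2) :
    δ ∈ expansions q x ↔ ∀ n, orb q x δ n ∈ Set.Icc 0 (1 / (q - 1)) := by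
  have hq0 : 0 < q := by linarith
  constructor
  · intro h n
    have h' : HasSum (fun i : ℕ => ((δ i : ℕ) : ℝ) / q ^ (i + 1)) x := h
    refine mem_Icc_of_mem_expansions hq (δ := fun i => δ (n + i)) ?_
    have h2 := ((hasSum_nat_add_iff' n).2 h').mul_left (q ^ n)
    rw [sub_partial_sum hq] at h2
    rw [mul_div_cancel₀ _ (pow_ne_zero n hq0.ne')] at h2
    refine hasSum_of_eq h2 fun i => ?_
    rw [add_comm i n, add_assoc, pow_add q n]
    field_simp
  · intro h
    change HasSum (fun i : ℕ => ((δ i : ℕ) : ℝ) / q ^ (i + 1)) x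
    rw [hasSum_iff_tendsto_nat_of_nonneg (fun i => by positivity)]
    have h0 : Tendsto (fun n => orb q x δ n / q ^ n) atTop (𝓝 0) := by
      have hb : Tendsto (fun n : ℕ => 1 / (q - 1) * (q⁻¹) ^ n) atTop (𝓝 0) := by
        simpa using (tendsto_pow_atTop_nhds_zero_of_lt_one (inv_nonneg.2 hq0.le)
          (inv_lt_one_of_one_lt₀ hq)).const_mul (1 / (q - 1))
      refine squeeze_zero (fun n => div_nonneg (h n).1 (by positivity)) (fun n => ?_) hb
      rw [inv_pow, ← div_eq_mul_inv]
      have := (h n).2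
      gcongr
    have h1 := (tendsto_const_nhds (x := x)).sub h0
    rw [sub_zero] at h1
    refine h1.congr fun n => ?_
    rw [← sub_partial_sum hq]; ring

/-- A property that every point passes on to one of its two children is kept by a whole orbit. -/
lemma exists_orb_forall {q x : ℝ} {X : ℝ → Prop} (h : ∀ y, X y → ∃ b : Fin 2, X (q * y - ((b : ℕ) : ℝ)))
    (hx : X x) : ∃ δ : ℕ → Fin 2, ∀ n, X (orb q x δ n) := by
  choose! f hf using h
  let p : ℕ → ℝ := fun n => Nat.rec x (fun _ y => q * y - ((f y : ℕ) : ℝ)) n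
  have hp : ∀ n, orb q x (fun n => f (p n)) n = p n := by
    intro n
    induction n with
    | zero => rfl
    | succ n ih => rw [orb_succ, ih]
  refine ⟨fun n => f (p n), fun n => ?_⟩
  rw [hp]
  induction n with
  | zero => exact hx
  | succ n ih => exact hf _ ih

lemma cons_mem {q : ℝ} (hq : 1 < q) {x : ℝ} {b : Fin 2} {δ : ℕ → Fin 2}
    (hδ : δ ∈ expansions q (q * x - ((b : ℕ) : ℝ))) : cons b δ ∈ expansions q x := by
  have hx := mem_Icc_of_mem_expansions hq hδ
  rw [mem_expansions_iff hq] at hδ ⊢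
  rintro (_ | n)
  · rw [orb_zero]
    have hb := digit_nonneg b
    have hb1 := digit_le_one b
    have h1 : (0 : ℝ) < q - 1 := by linarith
    have h2 := hx.2
    have h3 := hx.1
    rw [le_div_iff₀ h1] at h2
    constructor
    · by_contra! hc
      nlinarith
    · rw [le_div_iff₀ h1]
      nlinarith
  · rw [orb_cons]; exact hδ n

lemma tail_mem {q : ℝ} (hq : 1 < q) {x : ℝ} {δ : ℕ → Fin 2} (hδ : δ ∈ expansions q x) (n : ℕ) :
    (fun i => δ (n + i)) ∈ expansions q (orb q x δ n) := by
  rw [mem_expansions_iff hq] at hδ ⊢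
  intro m
  rw [← orb_add]
  exact hδ _

lemma cons_injective (b : Fin 2) : Function.Injective (cons b) := by
  intro δ η h
  funext n
  exact congrFun h (n + 1)

lemma expansions_eq_union {q : ℝ} (hq : 1 < q) (x : ℝ) :
    expansions q x = cons 0 '' expansions q (q * x) ∪ cons 1 '' expansions q (q * x - 1) := by
  ext δ
  constructor
  · intro h
    have h1 := tail_mem hq h 1
    rw [orb_succ, orb_zero] at h1
    rcases digit_cases (δ 0) with h0 | h0
    · refine Or.inl ⟨_, by simpa [h0] using h1, ?_⟩
      funext n
      cases n with
      | zero => exact h0.symm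
      | succ n => exact congrArg δ (add_comm _ _)
    · refine Or.inr ⟨_, by simpa [h0] using h1, ?_⟩
      funext n
      cases n with
      | zero => exact h0.symm
      | succ n => exact congrArg δ (add_comm _ _)
  · rintro (⟨η, hη, rfl⟩ | ⟨η, hη, rfl⟩)
    · exact cons_mem hq (by simpa using hη)
    · exact cons_mem hq (by simpa using hη)

lemma encard_expansions {q : ℝ} (hq : 1 < q) (x : ℝ) :
    (expansions q x).encard = (expansions q (q * x)).encard + (expansions q (q * x - 1)).encard := by
  rw [expansions_eq_union hq, Set.encard_union_eq, (cons_injective 0).encard_image,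
    (cons_injective 1).encard_image]
  rw [Set.disjoint_left]
  rintro _ ⟨η, _, rfl⟩ ⟨η', _, h⟩
  exact absurd (congrFun h 0) (by simp [cons])

lemma countable_image_iff {f : (ℕ → Fin 2) → ℕ → Fin 2} (hf : f.Injective) (s : Set (ℕ → Fin 2)) :
    (f '' s).Countable ↔ s.Countable :=
  ⟨Set.countable_of_injective_of_countable_image hf.injOn, fun h => h.image f⟩

lemma countable_expansions_iff {q : ℝ} (hq : 1 < q) (x : ℝ) :
    (expansions q x).Countable ↔
      (expansions q (q * x)).Countable ∧ (expansions q (q * x - 1)).Countable := by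
  rw [expansions_eq_union hq, Set.countable_union,
    countable_image_iff (cons_injective 0), countable_image_iff (cons_injective 1)]

lemma expansions_nonempty_iff {q : ℝ} (hq : 1 < q) (hq2 : q < 2) (x : ℝ) :
    (expansions q x).Nonempty ↔ x ∈ Set.Icc 0 (1 / (q - 1)) := by
  refine ⟨fun ⟨δ, h⟩ => mem_Icc_of_mem_expansions hq h, fun h => ?_⟩
  suffices hs : ∀ y ∈ Set.Icc 0 (1 / (q - 1)), ∃ b : Fin 2, q * y - ((b : ℕ) : ℝ) ∈ Set.Icc 0 (1 / (q - 1)) by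
    obtain ⟨δ, hδ⟩ := exists_orb_forall hs h
    exact ⟨δ, (mem_expansions_iff hq _ _).2 hδ⟩
  intro y hy
  have h1 : (0 : ℝ) < q - 1 := by linarith
  obtain ⟨h2, h3⟩ := hy
  rw [le_div_iff₀ h1] at h3
  rcases le_total (q * y) 1 with h4 | h4
  · refine ⟨0, by simp; nlinarith, ?_⟩
    rw [le_div_iff₀ h1]
    simp; nlinarith
  · refine ⟨1, by simpa using h4, ?_⟩
    rw [le_div_iff₀ h1]
    simp; nlinarith

lemma expansions_eq_empty {q : ℝ} (hq : 1 < q) {x : ℝ} (h : x < 0 ∨ 1 / (q - 1) < x) :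
    expansions q x = ∅ := by
  rw [Set.eq_empty_iff_forall_notMem]
  intro δ hδ
  have := mem_Icc_of_mem_expansions hq hδ
  rcases h with h | h
  · exact absurd this.1 (not_le.2 h)
  · exact absurd this.2 (not_le.2 h)

lemma rev_digit (b : Fin 2) : ((Fin.rev b : ℕ) : ℝ) = 1 - ((b : ℕ) : ℝ) := by
  rcases digit_cases b with rfl | rfl <;> simp

lemma orb_rev {q : ℝ} (hq : 1 < q) (x : ℝ) (δ : ℕ → Fin 2) (n : ℕ) :
    orb q (1 / (q - 1) - x) (fun i => (δ i).rev) n = 1 / (q - 1) - orb q x δ n := by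
  induction n with
  | zero => rfl
  | succ n ih =>
    have : q - 1 ≠ 0 := by linarith
    rw [orb_succ, orb_succ, ih, rev_digit]
    field_simp
    ring

lemma rev_mem {q : ℝ} (hq : 1 < q) {x : ℝ} {δ : ℕ → Fin 2} (h : δ ∈ expansions q x) :
    (fun i => (δ i).rev) ∈ expansions q (1 / (q - 1) - x) := by
  rw [mem_expansions_iff hq] at h ⊢
  intro n
  rw [orb_rev hq]
  exact ⟨by linarith [(h n).2], by linarith [(h n).1]⟩

lemma rev_injective : Function.Injective fun (δ : ℕ → Fin 2) i => (δ i).rev := by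
  intro δ η h
  funext n
  exact Fin.rev_injective (congrFun h n)

lemma expansions_reflect {q : ℝ} (hq : 1 < q) (x : ℝ) :
    expansions q (1 / (q - 1) - x) = (fun δ i => (δ i).rev) '' expansions q x := by
  ext δ
  constructor
  · intro h
    refine ⟨_, by simpa using rev_mem hq h, ?_⟩
    simp
  · rintro ⟨η, hη, rfl⟩
    exact rev_mem hq hη

lemma nontrivial_reflect {q : ℝ} (hq : 1 < q) (x : ℝ) :
    (expansions q (1 / (q - 1) - x)).Nontrivial ↔ (expansions q x).Nontrivial := by
  rw [expansions_reflect hq, Set.image_nontrivial rev_injective]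

lemma countable_reflect {q : ℝ} (hq : 1 < q) (x : ℝ) :
    (expansions q (1 / (q - 1) - x)).Countable ↔ (expansions q x).Countable := by
  rw [expansions_reflect hq, countable_image_iff rev_injective]

lemma encard_reflect {q : ℝ} (hq : 1 < q) (x : ℝ) :
    (expansions q (1 / (q - 1) - x)).encard = (expansions q x).encard := by
  rw [expansions_reflect hq, rev_injective.encard_image]

lemma countable_setOf_eq_lt {q : ℝ} (hq : 1 < q) {x : ℝ} {d : ℕ → Fin 2} (n : ℕ)
    (h : (expansions q (q * orb q x d n - (((d n).rev : ℕ) : ℝ))).Countable) :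
    {δ ∈ expansions q x | (∀ i < n, δ i = d i) ∧ δ n ≠ d n}.Countable := by
  refine Set.MapsTo.countable_of_injOn (f := fun δ i => δ (n + 1 + i)) ?_ ?_ h
  · rintro δ ⟨h1, h2, h3⟩
    have h4 := tail_mem hq h1 (n + 1)
    have h5 : δ n = (d n).rev := by
      rcases digit_cases (δ n) with h | h <;> rcases digit_cases (d n) with h' | h' <;>
        simp_all
    rwa [orb_succ, orb_congr q x h2, h5] at h4
  · rintro δ ⟨-, h2, h3⟩ η ⟨-, h2', h3'⟩ h
    funext i
    rcases lt_trichotomy i n with hi | rfl | hi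
    · rw [h2 i hi, h2' i hi]
    · rcases digit_cases (δ i) with h | h <;> rcases digit_cases (d i) with h' | h' <;>
        rcases digit_cases (η i) with h'' | h'' <;> simp_all
    · obtain ⟨j, rfl⟩ := Nat.exists_eq_add_of_lt hi
      have := congrFun h j
      simpa [add_right_comm] using this

/-- A point has countably many expansions if at all points of some orbit, all but countably many
expansions follow the orbit. -/
lemma countable_expansions_of_orbit {q : ℝ} (hq : 1 < q) {x : ℝ} {X : ℝ → Prop}
    (h : ∀ y, X y → ∃ b : Fin 2, X (q * y - ((b : ℕ) : ℝ)) ∧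
      (expansions q (q * y - ((b.rev : ℕ) : ℝ))).Countable) (hx : X x) :
    (expansions q x).Countable := by
  choose! f hf hf' using h
  obtain ⟨d, hd⟩ : ∃ d : ℕ → Fin 2, ∀ n, (expansions q (q * orb q x d n - (((d n).rev : ℕ) : ℝ))).Countable := by
    let p : ℕ → ℝ := fun n => Nat.rec x (fun _ y => q * y - ((f y : ℕ) : ℝ)) n
    have hp : ∀ n, orb q x (fun n => f (p n)) n = p n := by
      intro n
      induction n with
      | zero => rfl
      | succ n ih => rw [orb_succ, ih]
    have hX : ∀ n, X (p n) := by
      intro n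
      induction n with
      | zero => exact hx
      | succ n ih => exact hf _ ih
    refine ⟨fun n => f (p n), fun n => ?_⟩
    rw [hp]
    exact hf' _ (hX n)
  refine ((Set.countable_singleton d).union
    (Set.countable_iUnion fun n => countable_setOf_eq_lt hq n (hd n))).mono fun δ hδ => ?_
  by_cases hne : δ = d
  · exact Or.inl hne
  · right
    have hex : ∃ n, δ n ≠ d n := Function.ne_iff.1 hne
    classical
    rw [Set.mem_iUnion]
    refine ⟨Nat.find hex, hδ, fun i hi => ?_, Nat.find_spec hex⟩
    simpa using Nat.find_min hex hi

open Filter Topology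

/-- `z` has several expansions, but no two of them can be continued independently in several ways:
no point reached from `z` has two children with several expansions each. -/
def ThinlyBranching (q z : ℝ) : Prop :=
  (expansions q z).Nontrivial ∧ ∀ (δ : ℕ → Fin 2) (n : ℕ),
    ¬((expansions q (q * orb q z δ n)).Nontrivial ∧ (expansions q (q * orb q z δ n - 1)).Nontrivial)

lemma continuous_orb (q x : ℝ) (n : ℕ) : Continuous fun δ => orb q x δ n := by
  induction n with
  | zero => exact continuous_const
  | succ n ih =>
    have : Continuous fun δ : ℕ → Fin 2 => (((δ n : Fin 2) : ℕ) : ℝ) :=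
      (continuous_of_discreteTopology (f := fun b : Fin 2 => ((b : ℕ) : ℝ))).comp (continuous_apply n)
    exact (ih.const_mul q).sub this

lemma isClosed_expansions {q : ℝ} (hq : 1 < q) (x : ℝ) : IsClosed (expansions q x) := by
  have : expansions q x = ⋂ n, (fun δ => orb q x δ n) ⁻¹' Set.Icc 0 (1 / (q - 1)) := by
    ext δ
    simp only [mem_expansions_iff hq, Set.mem_iInter, Set.mem_preimage]
  rw [this]
  exact isClosed_iInter fun n => isClosed_Icc.preimage (continuous_orb q x n)

lemma not_countable_of_perfect {C : Set (ℕ → Fin 2)} (hC : Perfect C) (hne : C.Nonempty) :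
    ¬C.Countable := by
  let := TopologicalSpace.upgradeIsCompletelyMetrizable (ℕ → Fin 2)
  obtain ⟨f, hf, -, hinj⟩ := hC.exists_nat_bool_injection hne
  intro h
  have h1 : (Set.range f).Countable := h.mono hf
  rw [← Set.image_univ] at h1
  have h2 := Set.countable_of_injective_of_countable_image hinj.injOn h1
  have h3 : Cardinal.mk (ℕ → Bool) ≤ Cardinal.aleph0 := by
    rw [Cardinal.mk_le_aleph0_iff]
    exact Set.countable_univ_iff.1 h2
  have h4 : Cardinal.mk (ℕ → Bool) = Cardinal.continuum := by simp
  rw [h4] at h3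
  exact absurd h3 (not_le.2 Cardinal.aleph0_lt_continuum)

lemma nontrivial_of_child {q : ℝ} (hq : 1 < q) {x : ℝ} (b : Fin 2)
    (h : (expansions q (q * x - ((b : ℕ) : ℝ))).Nontrivial) : (expansions q x).Nontrivial := by
  refine (h.image (cons_injective b)).mono ?_
  rintro _ ⟨η, hη, rfl⟩
  exact cons_mem hq hη

lemma nontrivial_of_orb {q : ℝ} (hq : 1 < q) {x : ℝ} (δ : ℕ → Fin 2) (n : ℕ)
    (h : (expansions q (orb q x δ n)).Nontrivial) : (expansions q x).Nontrivial := by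
  induction n with
  | zero => exact h
  | succ n ih => exact ih (nontrivial_of_child hq _ h)

/-- The sequence that follows `δ` for `n` digits and then continues with `η`. -/
def splice (δ : ℕ → Fin 2) (n : ℕ) (η : ℕ → Fin 2) : ℕ → Fin 2 :=
  fun i => if i < n then δ i else η (i - n)

lemma splice_of_lt (δ : ℕ → Fin 2) {n i : ℕ} (η : ℕ → Fin 2) (h : i < n) : splice δ n η i = δ i :=
  if_pos h

lemma splice_add (δ : ℕ → Fin 2) (n : ℕ) (η : ℕ → Fin 2) (i : ℕ) : splice δ n η (n + i) = η i := by
  simp [splice]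

lemma orb_splice_of_le (q x : ℝ) (δ : ℕ → Fin 2) {n m : ℕ} (η : ℕ → Fin 2) (h : m ≤ n) :
    orb q x (splice δ n η) m = orb q x δ m :=
  orb_congr q x fun _ hi => splice_of_lt δ η (hi.trans_le h)

lemma orb_splice_add (q x : ℝ) (δ : ℕ → Fin 2) (n : ℕ) (η : ℕ → Fin 2) (m : ℕ) :
    orb q x (splice δ n η) (n + m) = orb q (orb q x δ n) η m := by
  rw [orb_add, orb_splice_of_le q x δ η le_rfl]
  congr 1
  funext i
  exact splice_add δ n η i

lemma nontrivial_orb_splice {q : ℝ} (hq : 1 < q) {x : ℝ} {δ η : ℕ → Fin 2} {n : ℕ}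
    (h : ∀ m, (expansions q (orb q (orb q x δ n) η m)).Nontrivial) (m : ℕ) :
    (expansions q (orb q x (splice δ n η) m)).Nontrivial := by
  rcases le_total m n with hm | hm
  · refine nontrivial_of_orb hq (fun i => splice δ n η (m + i)) (n - m) ?_
    rw [← orb_add, Nat.add_sub_cancel' hm, orb_splice_of_le q x δ η le_rfl]
    exact h 0
  · obtain ⟨k, rfl⟩ := Nat.exists_eq_add_of_le hm
    rw [orb_splice_add]
    exact h k

/-- If `x` has countably many but several expansions, then some point is thinly branching: otherwise
the expansions of `x` would contain a perfect set. -/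
theorem exists_thinlyBranching {q : ℝ} (hq : 1 < q) {x : ℝ} (hc : (expansions q x).Countable)
    (hx : (expansions q x).Nontrivial) : ∃ z, ThinlyBranching q z := by
  by_contra! hno
  have hrich : ∀ z, (expansions q z).Nontrivial → ∃ (δ : ℕ → Fin 2) (n : ℕ),
      ∀ b : Fin 2, (expansions q (q * orb q z δ n - ((b : ℕ) : ℝ))).Nontrivial := by
    intro z hz
    have h := hno z
    unfold ThinlyBranching at h
    push Not at h
    obtain ⟨δ, n, h0, h1⟩ := h hz
    refine ⟨δ, n, fun b => ?_⟩
    rcases digit_cases b with rfl | rfl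
    · simpa using h0
    · simpa using h1
  have hpath : ∀ z, (expansions q z).Nontrivial →
      ∃ δ : ℕ → Fin 2, ∀ n, (expansions q (orb q z δ n)).Nontrivial := by
    intro z hz
    refine exists_orb_forall (X := fun y => (expansions q y).Nontrivial) (fun y hy => ?_) hz
    obtain ⟨δ, n, h⟩ := hrich y hy
    cases n with
    | zero => exact ⟨0, h 0⟩
    | succ n =>
      refine ⟨δ 0, ?_⟩
      have h1 := nontrivial_of_child hq 0 (h 0)
      rw [add_comm, orb_add] at h1
      exact nontrivial_of_orb hq _ _ h1
  let D : Set (ℕ → Fin 2) := {δ | ∀ n, (expansions q (orb q x δ n)).Nontrivial}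
  have hD : Preperfect D := by
    rw [preperfect_iff_nhds]
    intro δ hδ U hU
    obtain ⟨_, ⟨α, n, rfl⟩, hα, hs⟩ := (PiNat.isTopologicalBasis_cylinders _).mem_nhds_iff.1 hU
    rw [PiNat.mem_cylinder_iff_eq] at hα
    rw [← hα] at hs
    obtain ⟨η, m, h⟩ := hrich _ (hδ n)
    obtain ⟨b, hb⟩ : ∃ b : Fin 2, b ≠ δ (n + m) := exists_ne _
    obtain ⟨θ, hθ⟩ := hpath _ (h b)
    have h1 : ∀ k, (expansions q (orb q (orb q (orb q x δ n) η m) (cons b θ) k)).Nontrivial := by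
      rintro (_ | k)
      · exact nontrivial_of_child hq 0 (h 0)
      · rw [orb_cons]; exact hθ k
    refine ⟨splice δ n (splice η m (cons b θ)), ⟨hs ?_, ?_⟩, fun heq => hb ?_⟩
    · rw [PiNat.mem_cylinder_iff]
      exact fun i hi => splice_of_lt δ _ hi
    · exact nontrivial_orb_splice hq (nontrivial_orb_splice hq h1)
    · rw [← heq, splice_add]
      exact (splice_add η m (cons b θ) 0).symm
  have hsub : closure D ⊆ expansions q x := by
    refine closure_minimal (fun δ hδ => ?_) (isClosed_expansions hq x)
    rw [mem_expansions_iff hq]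
    intro n
    obtain ⟨η, hη⟩ := (hδ n).nonempty
    exact mem_Icc_of_mem_expansions hq hη
  obtain ⟨δ, hδ⟩ := hpath x hx
  exact not_countable_of_perfect hD.perfect_closure ⟨δ, subset_closure hδ⟩ (hc.mono hsub)

lemma nontrivial_iff_one_lt {q x : ℝ} : (expansions q x).Nontrivial ↔ 1 < (expansions q x).encard :=
  Set.one_lt_encard_iff_nontrivial.symm

lemma encard_of_mul_lt_one {q x : ℝ} (hq : 1 < q) (h : q * x < 1) :
    (expansions q x).encard = (expansions q (q * x)).encard := by
  rw [encard_expansions hq, expansions_eq_empty hq (x := q * x - 1) (Or.inl (by linarith))]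
  simp

lemma nontrivial_mul_iff {q x : ℝ} (hq : 1 < q) (h : q * x < 1) :
    (expansions q (q * x)).Nontrivial ↔ (expansions q x).Nontrivial := by
  rw [nontrivial_iff_one_lt, nontrivial_iff_one_lt, encard_of_mul_lt_one hq h]

/-- The switch region: the points both of whose children have an expansion. -/
def switch (q : ℝ) : Set ℝ := {x | 1 ≤ q * x ∧ q * x ≤ 1 / (q - 1)}

lemma one_lt_inv_sub_one {q : ℝ} (hq : 1 < q) (hq2 : q < 2) : 1 < 1 / (q - 1) := by
  rw [lt_div_iff₀ (by linarith)]; linarith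

lemma nontrivial_of_mem_switch {q x : ℝ} (hq : 1 < q) (hq2 : q < 2) (h : x ∈ switch q) :
    (expansions q x).Nontrivial := by
  obtain ⟨h1, h2⟩ := h
  obtain ⟨δ, hδ⟩ := (expansions_nonempty_iff hq hq2 (q * x)).2 ⟨by linarith, h2⟩
  obtain ⟨η, hη⟩ := (expansions_nonempty_iff hq hq2 (q * x - 1)).2 ⟨by linarith, by linarith⟩
  refine ⟨cons 0 δ, cons_mem hq (by simpa using hδ), cons 1 η, cons_mem hq (by simpa using hη), ?_⟩
  exact fun h => absurd (congrFun h 0) (by simp [cons])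

lemma reflect_mem_switch {q x : ℝ} (hq : 1 < q) (h : x ∈ switch q) : 1 / (q - 1) - x ∈ switch q := by
  obtain ⟨h1, h2⟩ := h
  have h3 : q * (1 / (q - 1)) = 1 / (q - 1) + 1 := by
    have : q - 1 ≠ 0 := by linarith
    field_simp; ring
  constructor <;> rw [mul_sub, h3] <;> linarith

lemma ThinlyBranching.child {q z : ℝ} (h : ThinlyBranching q z) (b : Fin 2)
    (hn : (expansions q (q * z - ((b : ℕ) : ℝ))).Nontrivial) :
    ThinlyBranching q (q * z - ((b : ℕ) : ℝ)) := by
  refine ⟨hn, fun δ n => ?_⟩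
  have := h.2 (cons b δ) (n + 1)
  rwa [orb_cons] at this

lemma ThinlyBranching.mul {q z : ℝ} (h : ThinlyBranching q z)
    (hn : (expansions q (q * z)).Nontrivial) : ThinlyBranching q (q * z) := by
  have := h.child 0
  simp only [Fin.val_zero, Nat.cast_zero, sub_zero] at this
  exact this hn

lemma ThinlyBranching.of_orb {q z : ℝ} (h : ThinlyBranching q z) (δ : ℕ → Fin 2) (n : ℕ)
    (hn : (expansions q (orb q z δ n)).Nontrivial) : ThinlyBranching q (orb q z δ n) := by
  refine ⟨hn, fun η m => ?_⟩
  have := h.2 (splice δ n η) (n + m)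
  rwa [orb_splice_add] at this

lemma ThinlyBranching.reflect {q z : ℝ} (hq : 1 < q) (h : ThinlyBranching q z) :
    ThinlyBranching q (1 / (q - 1) - z) := by
  refine ⟨(nontrivial_reflect hq z).2 h.1, fun δ n hn => ?_⟩
  have h3 : q * (1 / (q - 1)) = 1 / (q - 1) + 1 := by
    have : q - 1 ≠ 0 := by linarith
    field_simp; ring
  have h1 := orb_rev hq z (fun i => (δ i).rev) n
  simp only [Fin.rev_rev] at h1
  rw [h1, mul_sub, h3] at hn
  refine h.2 (fun i => (δ i).rev) n ⟨?_, ?_⟩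
  · rw [← nontrivial_reflect hq]
    convert hn.2 using 2; ring
  · rw [← nontrivial_reflect hq]
    convert hn.1 using 2; ring

lemma ThinlyBranching.exists_mem_switch {q z : ℝ} (hq : 1 < q) (h : ThinlyBranching q z) :
    ∃ s ∈ switch q, ThinlyBranching q s := by
  classical
  obtain ⟨δ, hδ, η, hη, hne⟩ := h.1
  have hex : ∃ n, δ n ≠ η n := Function.ne_iff.1 hne
  have hlt : ∀ i < Nat.find hex, δ i = η i := fun i hi => by simpa using Nat.find_min hex hi
  set n := Nat.find hex with hn
  have hδη : δ n ≠ η n := Nat.find_spec hex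
  have h1 := (mem_expansions_iff hq _ _).1 hδ (n + 1)
  have h2 := (mem_expansions_iff hq _ _).1 hη (n + 1)
  rw [orb_succ] at h1 h2
  rw [← orb_congr q z hlt] at h2
  refine ⟨orb q z δ n, ?_, h.of_orb δ n ?_⟩
  · rcases digit_cases (δ n) with h0 | h0 <;> rcases digit_cases (η n) with h0' | h0'
    · exact absurd (h0.trans h0'.symm) hδη
    · rw [h0] at h1; rw [h0'] at h2
      simp only [Fin.val_zero, Fin.val_one, Nat.cast_zero, Nat.cast_one, Set.mem_Icc] at h1 h2
      exact ⟨by linarith [h2.1], by linarith [h1.2]⟩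
    · rw [h0] at h1; rw [h0'] at h2
      simp only [Fin.val_zero, Fin.val_one, Nat.cast_zero, Nat.cast_one, Set.mem_Icc] at h1 h2
      exact ⟨by linarith [h1.1], by linarith [h2.2]⟩
    · exact absurd (h0.trans h0'.symm) hδη
  · have h3 := tail_mem hq hη n
    rw [← orb_congr q z hlt] at h3
    refine ⟨_, tail_mem hq hδ n, _, h3, fun he => hδη ?_⟩
    simpa using congrFun he 0

/-- A point of the upper half of the attractor with a unique expansion is the fixed point of
`y ↦ q * (q * y - 1)`. -/
lemma eq_of_unique_upper {q : ℝ} (h1 : 1.618 < q) (hG : 0 < q ^ 2 - q - 1) (h3 : q < 1.6805) {x : ℝ}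
    (hx : ¬(expansions q x).Nontrivial) (hl : 1 ≤ q * x) (hu : x ≤ 1) : x = q / (q ^ 2 - 1) := by
  have hq : 1 < q := by linarith
  have hq2 : q < 2 := by linarith
  have hr : q * (1 / (q - 1)) = 1 / (q - 1) + 1 := by
    have : q - 1 ≠ 0 := by linarith
    field_simp; ring
  have hr2 : (q - 1) * (1 / (q - 1)) = 1 := mul_one_div_cancel (by linarith)
  set r := 1 / (q - 1) with hrdef
  have hr1 : 1 < r := one_lt_inv_sub_one hq hq2
  have hqv : (q ^ 2 - 1) * (q / (q ^ 2 - 1)) = q := mul_div_cancel₀ _ (by nlinarith)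
  set v := q / (q ^ 2 - 1) with hv
  have key : ∀ n : ℕ, ¬(expansions q (v + (q ^ 2) ^ n * (x - v))).Nontrivial ∧
      1 ≤ q * (v + (q ^ 2) ^ n * (x - v)) ∧ v + (q ^ 2) ^ n * (x - v) ≤ 1 := by
    intro n
    induction n with
    | zero =>
      have e : v + (q ^ 2) ^ 0 * (x - v) = x := by ring
      rw [e]
      exact ⟨hx, hl, hu⟩
    | succ n ih =>
      obtain ⟨i1, i2, i3⟩ := ih
      have e : v + (q ^ 2) ^ (n + 1) * (x - v) = q * (q * (v + (q ^ 2) ^ n * (x - v)) - 1) := by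
        linear_combination -hqv
      rw [e]
      set w := v + (q ^ 2) ^ n * (x - v)
      have j1 : r < q * w := by
        by_contra! hc
        exact i1 (nontrivial_of_mem_switch hq hq2 ⟨i2, hc⟩)
      have j2 : ¬(expansions q (q * w - 1)).Nontrivial := fun hn =>
        i1 (nontrivial_of_child hq 1 (by simpa using hn))
      have j3 : q * (q * w - 1) < 1 := by
        by_contra! hc
        refine j2 (nontrivial_of_mem_switch hq hq2 ⟨hc, ?_⟩)
        have : q * (q * w - 1) ≤ q * (q - 1) := by
          apply mul_le_mul_of_nonneg_left _ (by linarith)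
          nlinarith
        refine this.trans ?_
        rw [le_div_iff₀ (by linarith)]
        nlinarith
      refine ⟨fun hn => j2 ((nontrivial_mul_iff hq j3).1 hn), ?_, j3.le⟩
      have j4 : q * (q * (r - 1)) ≤ q * (q * (q * w - 1)) := by gcongr
      refine le_trans ?_ j4
      have : q * (q * (r - 1)) * (q - 1) = q ^ 2 * (2 - q) := by
        linear_combination q ^ 2 * hr2
      nlinarith
  by_contra hne
  have hpos : 0 < |x - v| := abs_pos.2 (sub_ne_zero.2 hne)
  obtain ⟨n, hn⟩ := pow_unbounded_of_one_lt ((1 + |v|) / |x - v|) (by nlinarith : 1 < q ^ 2)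
  rw [div_lt_iff₀ hpos] at hn
  obtain ⟨-, i2, i3⟩ := key n
  have hw : |v + (q ^ 2) ^ n * (x - v)| ≤ 1 := by
    rw [abs_le]
    refine ⟨?_, i3⟩
    by_contra! hc
    nlinarith
  have : (q ^ 2) ^ n * |x - v| = |(v + (q ^ 2) ^ n * (x - v)) - v| := by
    rw [add_sub_cancel_left, abs_mul, abs_of_nonneg (by positivity : 0 ≤ (q ^ 2) ^ n)]
  have h4 := abs_sub (v + (q ^ 2) ^ n * (x - v)) v
  linarith

lemma eq_of_unique {q : ℝ} (h1 : 1.618 < q) (hG : 0 < q ^ 2 - q - 1) (h3 : q < 1.6805) {x : ℝ}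
    (hx : ¬(expansions q x).Nontrivial) (h0 : 0 < x) (hl : q * x < 1) :
    ∃ k : ℕ, 1 ≤ k ∧ q ^ k * x = q / (q ^ 2 - 1) := by
  classical
  have hq : 1 < q := by linarith
  have hex : ∃ n : ℕ, 1 ≤ q * (q ^ n * x) := by
    obtain ⟨n, hn⟩ := pow_unbounded_of_one_lt (1 / x) hq
    rw [div_lt_iff₀ h0] at hn
    refine ⟨n, ?_⟩
    nlinarith
  have hmin : ∀ i < Nat.find hex, q * (q ^ i * x) < 1 := fun i hi => by
    simpa using Nat.find_min hex hi
  have hs := Nat.find_spec hex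
  set n := Nat.find hex
  have hn0 : n ≠ 0 := by
    intro h
    rw [h] at hs
    simp at hs
    linarith
  have hun : ∀ i ≤ n, ¬(expansions q (q ^ i * x)).Nontrivial := by
    intro i hi
    induction i with
    | zero => simpa using hx
    | succ i ih =>
      rw [pow_succ', mul_assoc, nontrivial_mul_iff hq (hmin i hi)]
      exact ih (by omega)
  refine ⟨n, Nat.one_le_iff_ne_zero.2 hn0, eq_of_unique_upper h1 hG h3 (hun n le_rfl) hs ?_⟩
  obtain ⟨m, hm⟩ := Nat.exists_eq_succ_of_ne_zero hn0
  have := hmin m (by omega)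
  rw [hm, Nat.succ_eq_add_one, pow_succ', mul_assoc]
  exact this.le

/-- The Bernstein polynomials of an interval are nonnegative there. -/
lemma bernstein_nonneg {q a b : ℝ} (ha : a < q) (hb : q < b) (i j : ℕ) :
    0 ≤ (q - a) ^ i * (b - q) ^ j :=
  mul_nonneg (pow_nonneg (by linarith) i) (pow_nonneg (by linarith) j)

/-- `a / (q ^ 2 - 1)` has the expansion `0 ^ ∞` or `0 ^ (k + 1) (1 0) ^ ∞` with `2 ≤ k`. -/
def IsTail (q a : ℝ) : Prop := a = 0 ∨ ∃ k : ℕ, 2 ≤ k ∧ q ^ k * a = 1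

/-- The reflection of the point `q * (1 / q + a / (q ^ 2 - 1))`. -/
noncomputable def follow (q a : ℝ) : ℝ := (2 + q - q ^ 2 - q * a) / (q ^ 2 - 1)

lemma IsTail.cases {q a : ℝ} (hq : 1 < q) (h : IsTail q a) :
    q ^ 2 * a = 1 ∨ q ^ 3 * a = 1 ∨ (0 ≤ a ∧ q ^ 4 * a ≤ 1) := by
  rcases h with rfl | ⟨k, hk, h⟩
  · right; right; simp
  · obtain rfl | rfl | hk : k = 2 ∨ k = 3 ∨ 4 ≤ k := by omega
    · exact Or.inl h
    · exact Or.inr (Or.inl h)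
    · right; right
      have ha : 0 < a := pos_of_mul_pos_right (by rw [h]; norm_num) (by positivity : 0 ≤ q ^ k)
      refine ⟨ha.le, ?_⟩
      rw [← h]
      have := pow_le_pow_right₀ hq.le hk
      gcongr

lemma pow_mul_mem_switch_iff {q a : ℝ} (hq : 1 < q) (n : ℕ) :
    q ^ n * follow q a ∈ switch q ↔ q ^ 2 - 1 ≤ q ^ (n + 1) * (2 + q - q ^ 2 - q * a) ∧
      q ^ (n + 1) * (2 + q - q ^ 2 - q * a) ≤ q + 1 := by
  have h1 : 0 < q ^ 2 - 1 := by nlinarith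
  have e : q * (q ^ n * follow q a) = q ^ (n + 1) * (2 + q - q ^ 2 - q * a) / (q ^ 2 - 1) := by
    rw [follow, pow_succ']; ring
  have e2 : 1 / (q - 1) = (q + 1) / (q ^ 2 - 1) := by
    have : q - 1 ≠ 0 := by linarith
    field_simp; ring
  change _ ≤ _ ∧ _ ≤ _ ↔ _
  rw [e, e2, one_le_div h1, div_le_div_iff_of_pos_right h1]

lemma mul_pow_mul_follow_lt_one_iff {q a : ℝ} (hq : 1 < q) (n : ℕ) :
    q * (q ^ n * follow q a) < 1 ↔ q ^ (n + 1) * (2 + q - q ^ 2 - q * a) < q ^ 2 - 1 := by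
  have h1 : 0 < q ^ 2 - 1 := by nlinarith
  have e : q * (q ^ n * follow q a) = q ^ (n + 1) * (2 + q - q ^ 2 - q * a) / (q ^ 2 - 1) := by
    rw [follow, pow_succ']; ring
  rw [e, div_lt_one h1]

/-- `follow q a` enters the switch region after exactly `n` multiplications by `q`. -/
def Lands (q a : ℝ) (n : ℕ) : Prop :=
  (∀ i < n, q * (q ^ i * follow q a) < 1) ∧ q ^ n * follow q a ∈ switch q

lemma lands_three {q a : ℝ} (h1 : 1.618 < q) (hG : 0 < q ^ 2 - q - 1) (h3 : q < 1.6805)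
    (ha : q ^ 2 * a = 1) : Lands q a 3 := by
  have hq : 1 < q := by linarith
  refine ⟨fun i hi => ?_, ?_⟩
  · rw [mul_pow_mul_follow_lt_one_iff hq]
    interval_cases i
    · have e : q ^ (0 + 1) * (2 + q - q ^ 2 - q * a) = 2 * q + q ^ 2 - q ^ 3 - 1 := by
        linear_combination (-1) * ha
      rw [e]
      nlinarith [mul_pos hG (by positivity : 0 < q)]
    · have e : q ^ (1 + 1) * (2 + q - q ^ 2 - q * a) = 2 * q ^ 2 + q ^ 3 - q ^ 4 - q := by
        linear_combination (-q) * ha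
      rw [e]
      nlinarith [mul_pos hG (by positivity : 0 < q ^ 2)]
    · have e : q ^ (2 + 1) * (2 + q - q ^ 2 - q * a) = 2 * q ^ 3 + q ^ 4 - q ^ 5 - q ^ 2 := by
        linear_combination (-q ^ 2) * ha
      rw [e]
      nlinarith [mul_pos hG (by nlinarith : 0 < q ^ 3 - q + 1)]
  · rw [pow_mul_mem_switch_iff hq]
    have e : q ^ (3 + 1) * (2 + q - q ^ 2 - q * a) = 2 * q ^ 4 + q ^ 5 - q ^ 6 - q ^ 3 := by
      linear_combination (-q ^ 3) * ha
    rw [e]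
    constructor
    · have B := bernstein_nonneg h1 h3
      linarith [B 0 6, B 1 5, B 2 4, B 3 3, B 4 2, B 5 1, B 6 0]
    · nlinarith [mul_pos hG (by nlinarith : 0 < q ^ 4 - q ^ 2 - 1)]

lemma lands_two {q a : ℝ} (h1 : 1.618 < q) (hG : 0 < q ^ 2 - q - 1) (h3 : q < 1.6805)
    (ha : q ^ 3 * a = 1) : Lands q a 2 := by
  have hq : 1 < q := by linarith
  refine ⟨fun i hi => ?_, ?_⟩
  · rw [mul_pow_mul_follow_lt_one_iff hq]
    interval_cases i
    · have : q * (q ^ (0 + 1) * (2 + q - q ^ 2 - q * a)) < q * (q ^ 2 - 1) := by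
        have e : q * (q ^ (0 + 1) * (2 + q - q ^ 2 - q * a)) = 2 * q ^ 2 + q ^ 3 - q ^ 4 - 1 := by
          linear_combination (-1) * ha
        rw [e]
        have B := bernstein_nonneg h1 h3
        nlinarith [B 0 4, B 1 3, B 2 2, B 3 1, B 4 0]
      exact lt_of_mul_lt_mul_left this (by linarith)
    · have e : q ^ (1 + 1) * (2 + q - q ^ 2 - q * a) = 2 * q ^ 2 + q ^ 3 - q ^ 4 - 1 := by
        linear_combination (-1) * ha
      rw [e]
      nlinarith [mul_pos hG (by positivity : 0 < q ^ 2)]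
  · rw [pow_mul_mem_switch_iff hq]
    have e : q ^ (2 + 1) * (2 + q - q ^ 2 - q * a) = 2 * q ^ 3 + q ^ 4 - q ^ 5 - q := by
      linear_combination (-q) * ha
    rw [e]
    constructor
    · have B := bernstein_nonneg h1 h3
      linarith [B 0 5, B 1 4, B 2 3, B 3 2, B 4 1, B 5 0]
    · nlinarith [mul_pos hG (by nlinarith : 0 < q ^ 3 - q - 1)]

lemma lands_one {q a : ℝ} (h1 : 1.618 < q) (hG : 0 < q ^ 2 - q - 1)
    (h3 : q ^ 5 - q ^ 4 - q ^ 3 - q + 1 ≤ 0)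
    (h0 : 0 ≤ a) (ha : q ^ 4 * a ≤ 1) : Lands q a 1 := by
  have hq : 1 < q := by linarith
  have ha2 : q ^ 2 * a * q ^ 2 ≤ 1 := by linarith
  refine ⟨fun i hi => ?_, ?_⟩
  · rw [mul_pow_mul_follow_lt_one_iff hq]
    interval_cases i
    rw [zero_add, pow_one]
    nlinarith [mul_nonneg (by positivity : 0 ≤ q ^ 2) h0, mul_pos hG (by positivity : 0 < q + 1)]
  · rw [pow_mul_mem_switch_iff hq]
    constructor
    · have : q * (q ^ 2 - 1) ≤ q * (q ^ (1 + 1) * (2 + q - q ^ 2 - q * a)) := by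
        rw [one_add_one_eq_two]
        linarith
      exact le_of_mul_le_mul_left this (by linarith)
    · rw [one_add_one_eq_two]
      nlinarith [mul_nonneg (by positivity : 0 ≤ q ^ 3) h0, mul_pos hG (by nlinarith : 0 < q ^ 2 - 1)]

lemma Lands.encard_eq {q a : ℝ} {n : ℕ} (hq : 1 < q) (h : Lands q a n) :
    ∀ i ≤ n, (expansions q (q ^ i * follow q a)).encard = (expansions q (follow q a)).encard := by
  intro i hi
  induction i with
  | zero => simp
  | succ i ih =>
    rw [pow_succ', mul_assoc, ← encard_of_mul_lt_one hq (h.1 i (by omega)), ih (by omega)]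

lemma Lands.nontrivial {q a : ℝ} {n : ℕ} (hq : 1 < q) (hq2 : q < 2) (h : Lands q a n) :
    (expansions q (follow q a)).Nontrivial := by
  rw [nontrivial_iff_one_lt, ← h.encard_eq hq n le_rfl, ← nontrivial_iff_one_lt]
  exact nontrivial_of_mem_switch hq hq2 h.2

lemma Lands.thinlyBranching {q a : ℝ} {n : ℕ} (hq : 1 < q) (h : Lands q a n)
    (ht : ThinlyBranching q (follow q a)) : ThinlyBranching q (q ^ n * follow q a) := by
  have : ∀ i ≤ n, ThinlyBranching q (q ^ i * follow q a) := by
    intro i hi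
    induction i with
    | zero => simpa using ht
    | succ i ih =>
      have ih := ih (by omega)
      rw [pow_succ', mul_assoc]
      exact ih.mul ((nontrivial_mul_iff hq (h.1 i (by omega))).2 ih.1)
  exact this n le_rfl

lemma IsTail.exists_lands {q a : ℝ} (h1 : 1.618 < q) (hG : 0 < q ^ 2 - q - 1)
    (h3 : q < 1.6805) (h3' : q ^ 5 - q ^ 4 - q ^ 3 - q + 1 ≤ 0) (h : IsTail q a) :
    ∃ n, Lands q a n := by
  rcases h.cases (by linarith) with h | h | ⟨h, h'⟩
  · exact ⟨3, lands_three h1 hG h3 h⟩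
  · exact ⟨2, lands_two h1 hG h3 h⟩
  · exact ⟨1, lands_one h1 hG h3' h h'⟩

lemma ThinlyBranching.exists_tail {q s : ℝ} (h1 : 1.618 < q) (hG : 0 < q ^ 2 - q - 1)
    (h3 : q < 1.6805) (h3' : q ^ 5 - q ^ 4 - q ^ 3 - q + 1 ≤ 0) (h : ThinlyBranching q s)
    (hs : s ∈ switch q) :
    ∃ a, IsTail q a ∧ ThinlyBranching q (follow q a) ∧
      (q * (q ^ 2 - 1) * s = q ^ 2 - 1 + q * a ∨
        q * (q ^ 2 - 1) * (1 / (q - 1) - s) = q ^ 2 - 1 + q * a) := by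
  have hq : 1 < q := by linarith
  have hq2 : q < 2 := by linarith
  have hr : q * (1 / (q - 1)) = 1 / (q - 1) + 1 := by
    have : q - 1 ≠ 0 := by linarith
    field_simp; ring
  have hr2 : (q ^ 2 - 1) * (1 / (q - 1)) = q + 1 := by
    have : q - 1 ≠ 0 := by linarith
    field_simp; ring
  have hq21 : 0 < q ^ 2 - 1 := by nlinarith
  have key : ∀ s, ThinlyBranching q s → s ∈ switch q → ¬(expansions q (q * s - 1)).Nontrivial →
      ∃ a, IsTail q a ∧ ThinlyBranching q (follow q a) ∧ q * (q ^ 2 - 1) * s = q ^ 2 - 1 + q * a := by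
    intro s h hs hn
    obtain ⟨s1, s2⟩ := hs
    have htail : IsTail q ((q ^ 2 - 1) * (q * s - 1) / q) := by
      rcases (by linarith : 0 ≤ q * s - 1).eq_or_lt with hu | hu
      · left
        rw [← hu]; simp
      · right
        have hlt : q * (q * s - 1) < 1 := by
          have : (q ^ 2 - 1) * (q * s) ≤ q + 1 := by rw [← hr2]; gcongr
          nlinarith
        obtain ⟨k, hk, hk'⟩ := eq_of_unique h1 hG h3 hn hu hlt
        rw [eq_div_iff hq21.ne'] at hk'
        refine ⟨k, ?_, ?_⟩
        · by_contra! hc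
          obtain rfl : k = 1 := by omega
          have : (q ^ 2 - 1) * (q * s) ≤ q + 1 := by rw [← hr2]; gcongr
          nlinarith
        · field_simp
          linarith
    have hf : follow q ((q ^ 2 - 1) * (q * s - 1) / q) = 1 / (q - 1) - q * s := by
      rw [follow, div_eq_iff hq21.ne', mul_div_cancel₀ _ (by linarith)]
      linear_combination -hr2
    refine ⟨_, htail, ?_, ?_⟩
    · obtain ⟨n, hn⟩ := htail.exists_lands h1 hG h3 h3'
      have := hn.nontrivial hq hq2
      rw [hf] at this ⊢
      exact (h.mul ((nontrivial_reflect hq _).1 this)).reflect hq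
    · rw [mul_div_cancel₀ _ (by linarith)]; ring
  by_cases hn : (expansions q (q * s - 1)).Nontrivial
  · have hn' : ¬(expansions q (q * (1 / (q - 1) - s) - 1)).Nontrivial := by
      intro hc
      refine h.2 (fun _ => 0) 0 ⟨?_, hn⟩
      rw [orb_zero, ← nontrivial_reflect hq]
      convert hc using 2
      rw [mul_sub, hr]; ring
    obtain ⟨a, ha, ha', e⟩ := key _ (h.reflect hq) (reflect_mem_switch hq hs) hn'
    exact ⟨a, ha, ha', Or.inr e⟩
  · obtain ⟨a, ha, ha', e⟩ := key s h hs hn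
    exact ⟨a, ha, ha', Or.inl e⟩

/-- The possible pairs of consecutive branching points. -/
def Step (q a a' : ℝ) : Prop :=
  (q ^ 2 * a = 1 ∧ (q * a' = -q ^ 6 + q ^ 5 + 2 * q ^ 4 - q ^ 3 - q ^ 2 + 1 ∨
    q * a' = (q ^ 2 - q - 1) * (q ^ 4 - q ^ 2 - 1))) ∨
  (q ^ 3 * a = 1 ∧ (q * a' = -q ^ 5 + q ^ 4 + 2 * q ^ 3 - q ^ 2 - q + 1 ∨
    q * a' = (q ^ 2 - q - 1) * (q ^ 3 - q - 1))) ∨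
  (q ^ 4 * a ≤ 1 ∧ (q * a' = -q ^ 4 + q ^ 3 + q ^ 2 + 1 - q ^ 3 * a ∨
    q * a' = (q ^ 2 - q - 1) * (q ^ 2 - 1) + q ^ 3 * a))

/-- The tail `a` occurs at a branching point. -/
def Occurs (q a : ℝ) : Prop := IsTail q a ∧ ThinlyBranching q (follow q a)

lemma Occurs.exists_step {q a : ℝ} (h1 : 1.618 < q) (hG : 0 < q ^ 2 - q - 1)
    (h3 : q < 1.6805) (h3' : q ^ 5 - q ^ 4 - q ^ 3 - q + 1 ≤ 0) (h : Occurs q a) :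
    ∃ a', Occurs q a' ∧ Step q a a' := by
  have hq : 1 < q := by linarith
  have hr2 : (q ^ 2 - 1) * (1 / (q - 1)) = q + 1 := by
    have : q - 1 ≠ 0 := by linarith
    field_simp; ring
  have hf : (q ^ 2 - 1) * follow q a = 2 + q - q ^ 2 - q * a :=
    mul_div_cancel₀ _ (by nlinarith)
  have key : ∀ n, Lands q a n → ∃ a', Occurs q a' ∧
      (q * a' = q ^ (n + 1) * (2 + q - q ^ 2 - q * a) - (q ^ 2 - 1) ∨
        q * a' = q + 1 - q ^ (n + 1) * (2 + q - q ^ 2 - q * a)) := by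
    intro n hn
    obtain ⟨a', h4, h5, h6⟩ :=
      (hn.thinlyBranching hq h.2).exists_tail h1 hG h3 h3' hn.2
    refine ⟨a', ⟨h4, h5⟩, h6.imp (fun e => ?_) (fun e => ?_)⟩
    · rw [pow_succ, ← hf]; linear_combination -e
    · rw [pow_succ, ← hf]; linear_combination -e + q * hr2
  rcases h.1.cases hq with ha | ha | ⟨ha, ha'⟩
  · obtain ⟨a', h4, h5⟩ := key 3 (lands_three h1 hG h3 ha)
    refine ⟨a', h4, Or.inl ⟨ha, h5.imp (fun e => ?_) (fun e => ?_)⟩⟩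
    · linear_combination e - q ^ 3 * ha
    · linear_combination e + q ^ 3 * ha
  · obtain ⟨a', h4, h5⟩ := key 2 (lands_two h1 hG h3 ha)
    refine ⟨a', h4, Or.inr (Or.inl ⟨ha, h5.imp (fun e => ?_) (fun e => ?_)⟩)⟩
    · linear_combination e - q * ha
    · linear_combination e + q * ha
  · obtain ⟨a', h4, h5⟩ := key 1 (lands_one h1 hG h3' ha ha')
    refine ⟨a', h4, Or.inr (Or.inr ⟨ha', h5.imp (fun e => ?_) (fun e => ?_)⟩)⟩
    · linear_combination e
    · linear_combination e

lemma exists_occurs {q x : ℝ} (h1 : 1.618 < q) (hG : 0 < q ^ 2 - q - 1)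
    (h3 : q < 1.6805) (h3' : q ^ 5 - q ^ 4 - q ^ 3 - q + 1 ≤ 0) (hc : (expansions q x).Countable)
    (hx : (expansions q x).Nontrivial) : ∃ a, Occurs q a := by
  have hq : 1 < q := by linarith
  obtain ⟨z, hz⟩ := exists_thinlyBranching hq hc hx
  obtain ⟨s, hs, hs'⟩ := hz.exists_mem_switch hq
  obtain ⟨a, ha, ha', -⟩ := hs'.exists_tail h1 hG h3 h3' hs
  exact ⟨a, ha, ha'⟩

lemma poly_bound_low_two {q : ℝ} (h1 : 1.618 < q) (h2 : q < 1.6455) :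
    1 < q * (-q ^ 6 + q ^ 5 + 2 * q ^ 4 - q ^ 3 - q ^ 2 + 1) := by
  have B := bernstein_nonneg h1 h2
  linarith [B 0 7, B 1 6, B 2 5, B 3 4, B 4 3, B 5 2, B 6 1, B 7 0]

lemma poly_bound_low_three {q : ℝ} (h1 : 1.618 < q) (h2 : q < 1.6455) :
    1 < q * (-q ^ 5 + q ^ 4 + 2 * q ^ 3 - q ^ 2 - q + 1) := by
  have B := bernstein_nonneg h1 h2
  linarith [B 0 6, B 1 5, B 2 4, B 3 3, B 4 2, B 5 1, B 6 0]

lemma poly_bound_low_three' {q : ℝ} (h1 : 1.618 < q) (h2 : q < 1.6455) :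
    q ^ 3 * ((q ^ 2 - q - 1) * (q ^ 3 - q - 1)) < 1 := by
  have B := bernstein_nonneg h1 h2
  linarith [B 0 8, B 1 7, B 2 6, B 3 5, B 4 4, B 5 3, B 6 2, B 7 1, B 8 0]

lemma poly_bound_two {q : ℝ} (h1 : 1.645 < q) (h2 : q < 1.6805) :
    1 < q ^ 3 * (-q ^ 6 + q ^ 5 + 2 * q ^ 4 - q ^ 3 - q ^ 2 + 1) := by
  have B := bernstein_nonneg h1 h2
  linarith [B 0 9, B 1 8, B 2 7, B 3 6, B 4 5, B 5 4, B 6 3, B 7 2, B 8 1, B 9 0]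

lemma poly_bound_three {q : ℝ} (h1 : 1.645 < q) (h2 : q < 1.6805) :
    1 < q ^ 2 * (-q ^ 5 + q ^ 4 + 2 * q ^ 3 - q ^ 2 - q + 1) := by
  have B := bernstein_nonneg h1 h2
  linarith [B 0 7, B 1 6, B 2 5, B 3 4, B 4 3, B 5 2, B 6 1, B 7 0]

lemma poly_bound_three' {q : ℝ} (h1 : 1.645 < q) (h2 : q < 1.6805) :
    q ^ 2 * ((q ^ 2 - q - 1) * (q ^ 3 - q - 1)) < 1 := by
  have B := bernstein_nonneg h1 h2
  linarith [B 0 7, B 1 6, B 2 5, B 3 4, B 4 3, B 5 2, B 6 1, B 7 0]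

lemma poly_bound_three'' {q : ℝ} (h1 : 1.645 < q) (h2 : q < 1.6805) :
    1 < q ^ 5 * ((q ^ 2 - q - 1) * (q ^ 3 - q - 1)) := by
  have B := bernstein_nonneg h1 h2
  linarith [B 0 10, B 1 9, B 2 8, B 3 7, B 4 6, B 5 5, B 6 4, B 7 3, B 8 2, B 9 1, B 10 0]

lemma poly_bound_four {q : ℝ} (h1 : 1.645 < q) (h2 : q < 1.6805) :
    1 < q ^ 3 * ((q ^ 2 - q - 1) * (q ^ 2 - 1) + (q ^ 2 * (-q ^ 4 + q ^ 3 + q ^ 2 + 1) - q)) := by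
  have B := bernstein_nonneg h1 h2
  linarith [B 0 9, B 1 8, B 2 7, B 3 6, B 4 5, B 5 4, B 6 3, B 7 2, B 8 1, B 9 0]

lemma root_bound_two {q : ℝ} (h1 : 1.645 < q) (h2 : q < 1.6805) (h : q ^ 2 * (-q ^ 6 + q ^ 5 + 2 * q ^ 4 - q ^ 3 - q ^ 2 + 1) = 1) :
    1.673 ≤ q ∧ q ≤ 1.674 := by
  constructor
  · by_contra! h3
    have B := bernstein_nonneg h1 h3
    linarith [B 0 8, B 1 7, B 2 6, B 3 5, B 4 4, B 5 3, B 6 2, B 7 1, B 8 0]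
  · by_contra! h3
    have B := bernstein_nonneg h3 h2
    linarith [B 0 8, B 1 7, B 2 6, B 3 5, B 4 4, B 5 3, B 6 2, B 7 1, B 8 0]

lemma root_bound_two' {q : ℝ} (h1 : 1.645 < q) (h2 : q < 1.6805) (h : q ^ 2 * ((q ^ 2 - q - 1) * (q ^ 4 - q ^ 2 - 1)) = 1) :
    1.659 ≤ q ∧ q ≤ 1.66 := by
  constructor
  · by_contra! h3
    have B := bernstein_nonneg h1 h3
    linarith [B 0 8, B 1 7, B 2 6, B 3 5, B 4 4, B 5 3, B 6 2, B 7 1, B 8 0]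
  · by_contra! h3
    have B := bernstein_nonneg h3 h2
    linarith [B 0 8, B 1 7, B 2 6, B 3 5, B 4 4, B 5 3, B 6 2, B 7 1, B 8 0]

lemma root_bound_three {q : ℝ} (h1 : 1.645 < q) (h2 : q < 1.6805) (h : q * (-q ^ 5 + q ^ 4 + 2 * q ^ 3 - q ^ 2 - q + 1) = 1) :
    1.675 ≤ q ∧ q ≤ 1.677 := by
  constructor
  · by_contra! h3
    have B := bernstein_nonneg h1 h3
    linarith [B 0 6, B 1 5, B 2 4, B 3 3, B 4 2, B 5 1, B 6 0]
  · by_contra! h3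
    have B := bernstein_nonneg h3 h2
    linarith [B 0 6, B 1 5, B 2 4, B 3 3, B 4 2, B 5 1, B 6 0]

lemma root_bound_three_four {q : ℝ} (h1 : 1.645 < q) (h2 : q < 1.6805) (h : q ^ 3 * ((q ^ 2 - q - 1) * (q ^ 3 - q - 1)) = 1) :
    1.666 ≤ q ∧ q ≤ 1.667 := by
  constructor
  · by_contra! h3
    have B := bernstein_nonneg h1 h3
    linarith [B 0 8, B 1 7, B 2 6, B 3 5, B 4 4, B 5 3, B 6 2, B 7 1, B 8 0]
  · by_contra! h3
    have B := bernstein_nonneg h3 h2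
    linarith [B 0 8, B 1 7, B 2 6, B 3 5, B 4 4, B 5 3, B 6 2, B 7 1, B 8 0]

lemma root_bound_three_five {q : ℝ} (h1 : 1.645 < q) (h2 : q < 1.6805) (h : q ^ 4 * ((q ^ 2 - q - 1) * (q ^ 3 - q - 1)) = 1) :
    1.65 ≤ q ∧ q ≤ 1.651 := by
  constructor
  · by_contra! h3
    have B := bernstein_nonneg h1 h3
    linarith [B 0 9, B 1 8, B 2 7, B 3 6, B 4 5, B 5 4, B 6 3, B 7 2, B 8 1, B 9 0]
  · by_contra! h3
    have B := bernstein_nonneg h3 h2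
    linarith [B 0 9, B 1 8, B 2 7, B 3 6, B 4 5, B 5 4, B 6 3, B 7 2, B 8 1, B 9 0]

/-- No power of `q` lies strictly between two consecutive powers. -/
lemma IsTail.gap {q a : ℝ} (hq : 1 < q) (h : IsTail q a) {m : ℕ} (hm : q ^ m * a < 1) :
    q ^ (m + 1) * a ≤ 1 := by
  rcases h with rfl | ⟨k, -, h⟩
  · simp
  · have ha : 0 < a := pos_of_mul_pos_right (by rw [h]; norm_num) (by positivity : 0 ≤ q ^ k)
    rw [← h] at hm ⊢
    have : m < k := (pow_lt_pow_iff_right₀ hq).1 (lt_of_mul_lt_mul_right hm ha.le)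
    have := pow_le_pow_right₀ hq.le (by omega : m + 1 ≤ k)
    gcongr

lemma IsTail.sq_mul_le {q a : ℝ} (hq : 1 < q) (h : IsTail q a) : q ^ 2 * a ≤ 1 := by
  rcases h with rfl | ⟨k, hk, h⟩
  · simp
  · have ha : 0 < a := pos_of_mul_pos_right (by rw [h]; norm_num) (by positivity : 0 ≤ q ^ k)
    rw [← h]
    have := pow_le_pow_right₀ hq.le hk
    gcongr

lemma IsTail.le_of_lt {q a : ℝ} (hq : 1 < q) (h : IsTail q a) {m : ℕ} (hm : 1 < q ^ (m + 1) * a) :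
    1 ≤ q ^ m * a := by
  by_contra! hc
  exact absurd (h.gap hq hc) (not_le.2 hm)

lemma IsTail.eq_of_one_lt {q a : ℝ} (hq : 1 < q) (h : IsTail q a) (hm : 1 < q ^ 4 * a) :
    q ^ 2 * a = 1 ∨ q ^ 3 * a = 1 := by
  rcases (h.le_of_lt hq hm).eq_or_lt with h3 | h3
  · exact Or.inr h3.symm
  · exact Or.inl (le_antisymm (h.sq_mul_le hq) (h.le_of_lt hq h3))

lemma IsTail.nonneg {q a : ℝ} (hq : 1 < q) (h : IsTail q a) : 0 ≤ a := by
  rcases h with rfl | ⟨k, hk, h⟩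
  · exact le_rfl
  · exact (pos_of_mul_pos_right (by rw [h]; norm_num) (by positivity : 0 ≤ q ^ k)).le

/-- Two reflected short passages never follow each other. -/
lemma IsTail.not_reflected_twice {q a a' : ℝ} (h1 : 1.618 < q) (hG : 0 < q ^ 2 - q - 1)
    (ha : IsTail q a) (ha' : IsTail q a') (h5 : q ^ 5 * a ≤ 1)
    (hQ : (q ^ 2 - q - 1) * (q ^ 2 - 1) < (q ^ 4 - q ^ 3) * a)
    (h : q * a' = (q ^ 2 - q - 1) * (q ^ 2 - 1) + q ^ 3 * a) : False := by
  have hq : 1 < q := by linarith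
  have hc : 0 < (q ^ 2 - q - 1) * (q ^ 2 - 1) := mul_pos hG (by nlinarith)
  rcases ha with rfl | ⟨k, hk, hka⟩
  · simp at hQ; linarith
  · obtain ⟨n, rfl⟩ : ∃ n, k = n + 3 := by
      refine ⟨k - 3, (Nat.sub_add_cancel ?_).symm⟩
      by_contra! hlt
      obtain rfl : k = 2 := by omega
      have : q ^ 5 * a = q ^ 3 := by linear_combination q ^ 3 * hka
      rw [this] at h5
      exact absurd h5 (not_le.2 (one_lt_pow₀ hq (by norm_num)))
    have hp : 0 < q ^ n := by positivity
    have e1 : q ^ (n + 1) * a' = q ^ n * (q * a') := by ring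
    have e2 : q * (q ^ n * a') = q ^ n * (q * a') := by ring
    have e3 : q ^ n * (q ^ 3 * a) = 1 := by rw [← hka]; ring
    have e4 : q ^ n * (q ^ 4 * a) = q * 1 := by rw [← hka]; ring
    have l1 : 1 < q ^ (n + 1) * a' := by
      rw [e1, h]
      nth_rw 1 [← e3]
      exact mul_lt_mul_of_pos_left (by linarith) hp
    have l2 : q ^ n * a' < 1 := by
      have : q * (q ^ n * a') < q * 1 := by
        rw [e2, h, ← e4]
        exact mul_lt_mul_of_pos_left (by linarith) hp
      exact lt_of_mul_lt_mul_left this (by linarith)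
    exact absurd (ha'.gap hq l2) (not_le.2 l1)

/-- The reflected step from a small tail. -/
lemma lt_of_reflected {q a a' : ℝ} (h1 : 1.618 < q) (hG : 0 < q ^ 2 - q - 1)
    (ha : 0 ≤ a) (h : q * a' = (q ^ 2 - q - 1) * (q ^ 2 - 1) + q ^ 3 * a) :
    (q ^ 2 - q - 1) * (q ^ 2 - 1) < (q ^ 4 - q ^ 3) * a' := by
  have hc : 0 < (q ^ 2 - q - 1) * (q ^ 2 - 1) := mul_pos hG (by nlinarith)
  have h3 : (q ^ 2 - q - 1) * (q ^ 2 - 1) ≤ q * a' := by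
    rw [h]; have : 0 ≤ q ^ 3 * a := by positivity
    linarith
  have h4 : (q ^ 4 - q ^ 3) * a' = (q ^ 3 - q ^ 2) * (q * a') := by ring
  rw [h4]
  have : 1 < q ^ 3 - q ^ 2 := by nlinarith
  nlinarith

lemma pow_mul_ne_one_of_le {q a : ℝ} (hq : 1 < q) {m n : ℕ} (h : q ^ (m + n + 1) * a ≤ 1) :
    q ^ m * a ≠ 1 := by
  intro h2
  have : q ^ (m + n + 1) * a = q ^ (n + 1) := by linear_combination q ^ (n + 1) * h2
  rw [this] at h
  exact absurd h (not_le.2 (one_lt_pow₀ hq (by omega)))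

lemma sq_mul_bound {q : ℝ} (h1 : 1.618 < q) (hG : 0 < q ^ 2 - q - 1) : q ^ 2 * (-q ^ 4 + q ^ 3 + q ^ 2 + 1) < q + 1 := by
  nlinarith [mul_pos hG (by nlinarith [pow_pos (by linarith : 0 < q) 2] : 0 < q ^ 4 - 1)]

/-- Below the first exceptional base, a small tail is followed by a reflected one. -/
lemma Occurs.reflected_of_low {q a : ℝ} (h1 : 1.618 < q) (hG : 0 < q ^ 2 - q - 1)
    (h3 : q < 1.6805) (h3' : q ^ 5 - q ^ 4 - q ^ 3 - q + 1 ≤ 0) (hp1 : q ^ 6 - q ^ 4 - q ^ 3 - 2 * q ^ 2 - q - 1 < 0)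
    (h : Occurs q a) (h5 : q ^ 5 * a ≤ 1) :
    ∃ a', Occurs q a' ∧ q * a' = (q ^ 2 - q - 1) * (q ^ 2 - 1) + q ^ 3 * a := by
  have hq : 1 < q := by linarith
  obtain ⟨a', ha', hs⟩ := h.exists_step h1 hG h3 h3'
  rcases hs with ⟨hs, -⟩ | ⟨hs, -⟩ | ⟨-, hs | hs⟩
  · exact absurd hs (pow_mul_ne_one_of_le (m := 2) (n := 2) hq h5)
  · exact absurd hs (pow_mul_ne_one_of_le (m := 3) (n := 1) hq h5)
  · exfalso
    have hg : q ^ 2 + 1 < q ^ 3 * (-q ^ 4 + q ^ 3 + q ^ 2 + 1) := by nlinarith [mul_neg_of_neg_of_pos hp1 (by linarith : 0 < q - 1)]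
    rcases le_or_gt (q ^ 6 * a) 1 with h6 | h6
    · have e : q ^ 2 * (q ^ 2 * a') = q ^ 3 * (-q ^ 4 + q ^ 3 + q ^ 2 + 1) - q ^ 6 * a := by linear_combination q ^ 3 * hs
      have := ha'.1.sq_mul_le hq
      nlinarith
    · have h5' : q ^ 5 * a = 1 := le_antisymm h5 (h.1.le_of_lt hq h6)
      have e : q * (q ^ 3 * a') = q ^ 3 * (-q ^ 4 + q ^ 3 + q ^ 2 + 1) - q := by linear_combination q ^ 3 * hs - q * h5'
      have l1 : 1 < q ^ 3 * a' := by
        have : q * 1 < q * (q ^ 3 * a') := by rw [e]; nlinarith [sq_pos_of_pos (by linarith : 0 < q - 1)]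
        exact lt_of_mul_lt_mul_left this (by linarith)
      have e2 : q * (q ^ 2 * a') = q ^ 2 * (-q ^ 4 + q ^ 3 + q ^ 2 + 1) - 1 := by linear_combination q ^ 2 * hs - h5'
      have l2 : q ^ 2 * a' < 1 := by
        have : q * (q ^ 2 * a') < q * 1 := by rw [e2]; linarith [sq_mul_bound h1 hG]
        exact lt_of_mul_lt_mul_left this (by linarith)
      exact absurd (ha'.1.gap hq l2) (not_le.2 l1)
  · exact ⟨a', ha', hs⟩

lemma not_occurs_of_low {q a : ℝ} (h1 : 1.618 < q) (hG : 0 < q ^ 2 - q - 1)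
    (h3 : q < 1.6805) (h3' : q ^ 5 - q ^ 4 - q ^ 3 - q + 1 ≤ 0) (hp1 : q ^ 6 - q ^ 4 - q ^ 3 - 2 * q ^ 2 - q - 1 < 0) : ¬Occurs q a := by
  have hq : 1 < q := by linarith
  have h2 : q < 1.6455 := by
    by_contra! hc
    have B := bernstein_nonneg (by linarith : 1.6454 < q) h3
    linarith [B 0 6, B 1 5, B 2 4, B 3 3, B 4 2, B 5 1, B 6 0]
  have small : ∀ a, Occurs q a → q ^ 5 * a ≤ 1 →
      ¬(q ^ 2 - q - 1) * (q ^ 2 - 1) < (q ^ 4 - q ^ 3) * a := by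
    intro a h h5 hQ
    obtain ⟨a', ha', hs⟩ := h.reflected_of_low h1 hG h3 h3' hp1 h5
    exact h.1.not_reflected_twice h1 hG ha'.1 h5 hQ hs
  have two : ∀ a, Occurs q a → q ^ 2 * a ≠ 1 := by
    intro a h h2a
    obtain ⟨a', ha', hs⟩ := h.exists_step h1 hG h3 h3'
    rcases hs with ⟨-, hs | hs⟩ | ⟨hs, -⟩ | ⟨hs, -⟩
    · have e : q ^ 2 * a' = q * (-q ^ 6 + q ^ 5 + 2 * q ^ 4 - q ^ 3 - q ^ 2 + 1) := by linear_combination q * hs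
      have := ha'.1.sq_mul_le hq
      rw [e] at this
      exact absurd this (not_le.2 (poly_bound_low_two h1 h2))
    · have e : q ^ 4 * a' = q ^ 3 * ((q ^ 2 - q - 1) * (q ^ 4 - q ^ 2 - 1)) := by linear_combination q ^ 3 * hs
      have l : q ^ 4 * a' < 1 := by
        rw [e]
        nlinarith [mul_neg_of_neg_of_pos hp1 (by nlinarith [mul_pos (sq_pos_of_pos (by linarith : 0 < q - 1)) (by linarith : 0 < q + 1)] : 0 < (q - 1) ^ 2 * (q + 1))]
      refine small a' ha' (ha'.1.gap hq l) ?_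
      have e : (q ^ 4 - q ^ 3) * a' = (q ^ 2 - q - 1) * ((q ^ 3 - q ^ 2) * (q ^ 4 - q ^ 2 - 1)) := by
        linear_combination (q ^ 3 - q ^ 2) * hs
      rw [e]
      refine mul_lt_mul_of_pos_left ?_ hG
      nlinarith [mul_pos hG (by linarith : 0 < q)]
    · exact pow_mul_ne_one_of_le (m := 2) (n := 0) hq hs.le h2a
    · exact pow_mul_ne_one_of_le (m := 2) (n := 1) hq hs h2a
  have three : ∀ a, Occurs q a → q ^ 3 * a ≠ 1 := by
    intro a h h3a
    obtain ⟨a', ha', hs⟩ := h.exists_step h1 hG h3 h3'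
    rcases hs with ⟨hs, -⟩ | ⟨-, hs | hs⟩ | ⟨hs, -⟩
    · exact pow_mul_ne_one_of_le (m := 2) (n := 0) hq h3a.le hs
    · have e : q ^ 2 * a' = q * (-q ^ 5 + q ^ 4 + 2 * q ^ 3 - q ^ 2 - q + 1) := by linear_combination q * hs
      have := ha'.1.sq_mul_le hq
      rw [e] at this
      exact absurd this (not_le.2 (poly_bound_low_three h1 h2))
    · have e : q ^ 4 * a' = q ^ 3 * ((q ^ 2 - q - 1) * (q ^ 3 - q - 1)) := by linear_combination q ^ 3 * hs
      have l : q ^ 4 * a' < 1 := by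
        rw [e]
        exact poly_bound_low_three' h1 h2
      refine small a' ha' (ha'.1.gap hq l) ?_
      have e : (q ^ 4 - q ^ 3) * a' = (q ^ 2 - q - 1) * ((q ^ 3 - q ^ 2) * (q ^ 3 - q - 1)) := by
        linear_combination (q ^ 3 - q ^ 2) * hs
      rw [e]
      refine mul_lt_mul_of_pos_left ?_ hG
      nlinarith [mul_pos hG (by linarith : 0 < q)]
    · exact pow_mul_ne_one_of_le (m := 3) (n := 0) hq hs h3a
  have four : ∀ a, Occurs q a → q ^ 4 * a ≠ 1 := by
    intro a h h4a
    obtain ⟨a', ha', hs⟩ := h.exists_step h1 hG h3 h3'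
    rcases hs with ⟨hs, -⟩ | ⟨hs, -⟩ | ⟨-, hs | hs⟩
    · exact two a h hs
    · exact three a h hs
    · have hg : q ^ 2 + 1 < q ^ 3 * (-q ^ 4 + q ^ 3 + q ^ 2 + 1) := by nlinarith [mul_neg_of_neg_of_pos hp1 (by linarith : 0 < q - 1)]
      have e : q ^ 4 * a' = q ^ 3 * (-q ^ 4 + q ^ 3 + q ^ 2 + 1) - q ^ 2 := by linear_combination q ^ 3 * hs - q ^ 2 * h4a
      rcases ha'.1.eq_of_one_lt hq (by rw [e]; linarith) with h' | h'
      · exact two a' ha' h'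
      · exact three a' ha' h'
    · have e : q ^ 4 * a' = q ^ 3 * ((q ^ 2 - q - 1) * (q ^ 2 - 1)) + q ^ 2 := by
        linear_combination q ^ 3 * hs + q ^ 2 * h4a
      have hc : 0 < (q ^ 2 - q - 1) * (q ^ 2 - 1) := mul_pos hG (by nlinarith)
      have : 0 < q ^ 3 * ((q ^ 2 - q - 1) * (q ^ 2 - 1)) := by positivity
      rcases ha'.1.eq_of_one_lt hq (by rw [e]; nlinarith) with h' | h'
      · exact two a' ha' h'
      · exact three a' ha' h'
  have all : ∀ a, Occurs q a → q ^ 5 * a ≤ 1 := by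
    intro a h
    refine h.1.gap hq (lt_of_le_of_ne ?_ (four a h))
    by_contra! hc
    rcases h.1.eq_of_one_lt hq hc with h' | h'
    · exact two a h h'
    · exact three a h h'
  intro h
  obtain ⟨a', ha', hs⟩ := h.reflected_of_low h1 hG h3 h3' hp1 (all a h)
  exact small a' ha' (all a' ha') (lt_of_reflected h1 hG (h.1.nonneg hq) hs)

lemma not_occurs_of_high {q a : ℝ} (h1 : 1.618 < q) (hG : 0 < q ^ 2 - q - 1)
    (h3 : q < 1.6805) (h3' : q ^ 5 - q ^ 4 - q ^ 3 - q + 1 < 0) (hp1 : 0 < q ^ 6 - q ^ 4 - q ^ 3 - 2 * q ^ 2 - q - 1)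
    (hp2 : q ^ 6 - 2 * q ^ 4 - q ^ 3 - 1 ≠ 0) : ¬Occurs q a := by
  have hq : 1 < q := by linarith
  have h2 : 1.645 < q := by
    by_contra! hc
    have B := bernstein_nonneg h1 (by linarith : q < 1.6451)
    linarith [B 0 6, B 1 5, B 2 4, B 3 3, B 4 2, B 5 1, B 6 0]
  have two' : ∀ a, Occurs q a → q ^ 2 * a = 1 → ∃ a', Occurs q a' ∧ q ^ 3 * a' = 1 ∧
      (q ^ 2 * (-q ^ 6 + q ^ 5 + 2 * q ^ 4 - q ^ 3 - q ^ 2 + 1) = 1 ∨ q ^ 2 * ((q ^ 2 - q - 1) * (q ^ 4 - q ^ 2 - 1)) = 1) := by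
    intro a h h2a
    obtain ⟨a', ha', hs⟩ := h.exists_step h1 hG h3 h3'.le
    refine ⟨a', ha', ?_⟩
    rcases hs with ⟨-, hs | hs⟩ | ⟨hs, -⟩ | ⟨hs, -⟩
    · have e : q ^ 4 * a' = q ^ 3 * (-q ^ 6 + q ^ 5 + 2 * q ^ 4 - q ^ 3 - q ^ 2 + 1) := by linear_combination q ^ 3 * hs
      have e3 : q ^ 3 * a' = q ^ 2 * (-q ^ 6 + q ^ 5 + 2 * q ^ 4 - q ^ 3 - q ^ 2 + 1) := by linear_combination q ^ 2 * hs
      rcases ha'.1.eq_of_one_lt hq (by rw [e]; exact poly_bound_two h2 h3) with h' | h'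
      · exfalso
        have e2 : (q - 1) * (q ^ 6 - 2 * q ^ 4 - q ^ 3 - 1) = 0 := by
          linear_combination q * hs - h'
        rcases mul_eq_zero.1 e2 with h0 | h0
        · linarith
        · exact hp2 h0
      · exact ⟨h', Or.inl (by rw [← e3, h'])⟩
    · have e : q ^ 4 * a' = q ^ 3 * ((q ^ 2 - q - 1) * (q ^ 4 - q ^ 2 - 1)) := by linear_combination q ^ 3 * hs
      have e3 : q ^ 3 * a' = q ^ 2 * ((q ^ 2 - q - 1) * (q ^ 4 - q ^ 2 - 1)) := by linear_combination q ^ 2 * hs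
      have l : 1 < q ^ 4 * a' := by
        rw [e]
        nlinarith [mul_pos hp1 (by nlinarith [mul_pos (sq_pos_of_pos (by linarith : 0 < q - 1)) (by linarith : 0 < q + 1)] : 0 < (q - 1) ^ 2 * (q + 1))]
      rcases ha'.1.eq_of_one_lt hq l with h' | h'
      · exfalso
        have e2 : q ^ 2 * a' = q * ((q ^ 2 - q - 1) * (q ^ 4 - q ^ 2 - 1)) := by linear_combination q * hs
        nlinarith [mul_neg_of_neg_of_pos h3' (by nlinarith : 0 < q ^ 2 - 1)]
      · exact ⟨h', Or.inr (by rw [← e3, h'])⟩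
    · exact absurd h2a (pow_mul_ne_one_of_le (m := 2) (n := 0) hq hs.le)
    · exact absurd h2a (pow_mul_ne_one_of_le (m := 2) (n := 1) hq hs)
  have three' : ∀ a, Occurs q a → q ^ 3 * a = 1 → ∃ a', Occurs q a' ∧
      (q ^ 2 * a' = 1 ∧ q * (-q ^ 5 + q ^ 4 + 2 * q ^ 3 - q ^ 2 - q + 1) = 1 ∨ q ^ 4 * a' = 1 ∧ q ^ 3 * ((q ^ 2 - q - 1) * (q ^ 3 - q - 1)) = 1 ∨
        q ^ 5 * a' = 1 ∧ q ^ 4 * ((q ^ 2 - q - 1) * (q ^ 3 - q - 1)) = 1) := by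
    intro a h h3a
    obtain ⟨a', ha', hs⟩ := h.exists_step h1 hG h3 h3'.le
    refine ⟨a', ha', ?_⟩
    rcases hs with ⟨hs, -⟩ | ⟨-, hs | hs⟩ | ⟨hs, -⟩
    · exact absurd hs (pow_mul_ne_one_of_le (m := 2) (n := 0) hq h3a.le)
    · have e : q ^ 3 * a' = q ^ 2 * (-q ^ 5 + q ^ 4 + 2 * q ^ 3 - q ^ 2 - q + 1) := by linear_combination q ^ 2 * hs
      have h' : q ^ 2 * a' = 1 := le_antisymm (ha'.1.sq_mul_le hq)
        (ha'.1.le_of_lt hq (by rw [e]; exact poly_bound_three h2 h3))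
      exact Or.inl ⟨h', by linear_combination h' - q * hs⟩
    · have e3 : q ^ 3 * a' = q ^ 2 * ((q ^ 2 - q - 1) * (q ^ 3 - q - 1)) := by linear_combination q ^ 2 * hs
      have e6 : q ^ 6 * a' = q ^ 5 * ((q ^ 2 - q - 1) * (q ^ 3 - q - 1)) := by linear_combination q ^ 5 * hs
      have l4 : q ^ 4 * a' ≤ 1 := ha'.1.gap hq (by rw [e3]; exact poly_bound_three' h2 h3)
      have l5 : 1 ≤ q ^ 5 * a' := ha'.1.le_of_lt hq (by rw [e6]; exact poly_bound_three'' h2 h3)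
      right
      rcases l4.eq_or_lt with h' | h'
      · exact Or.inl ⟨h', by linear_combination h' - q ^ 3 * hs⟩
      · have h' := le_antisymm (ha'.1.gap hq h') l5
        exact Or.inr ⟨h', by linear_combination h' - q ^ 4 * hs⟩
    · exact absurd h3a (pow_mul_ne_one_of_le (m := 3) (n := 0) hq hs)
  have two : ∀ a, Occurs q a → q ^ 2 * a ≠ 1 := by
    intro a h h2a
    obtain ⟨a', ha', h3a, hE⟩ := two' a h h2a
    obtain ⟨_, _, hF⟩ := three' a' ha' h3a
    have hE' : (1.673 ≤ q ∧ q ≤ 1.674) ∨ (1.659 ≤ q ∧ q ≤ 1.66) :=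
      hE.imp (root_bound_two h2 h3) (root_bound_two' h2 h3)
    have hF' : (1.675 ≤ q ∧ q ≤ 1.677) ∨ (1.666 ≤ q ∧ q ≤ 1.667) ∨ (1.65 ≤ q ∧ q ≤ 1.651) :=
      hF.imp (fun h => root_bound_three h2 h3 h.2)
        (Or.imp (fun h => root_bound_three_four h2 h3 h.2) (fun h => root_bound_three_five h2 h3 h.2))
    rcases hE' with ⟨_, _⟩ | ⟨_, _⟩ <;> rcases hF' with ⟨_, _⟩ | ⟨_, _⟩ | ⟨_, _⟩ <;> linarith
  have three : ∀ a, Occurs q a → q ^ 3 * a ≠ 1 := by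
    intro a h h3a
    obtain ⟨b, hb, ⟨hF, -⟩ | ⟨hF, hE⟩ | ⟨hF, hE⟩⟩ := three' a h h3a
    · exact two b hb hF
    · obtain ⟨b1, b2⟩ := root_bound_three_four h2 h3 hE
      obtain ⟨c, hc, hs⟩ := hb.exists_step h1 hG h3 h3'.le
      rcases hs with ⟨hs, -⟩ | ⟨hs, -⟩ | ⟨-, hs | hs⟩
      · exact two b hb hs
      · exact pow_mul_ne_one_of_le (m := 3) (n := 0) hq hF.le hs
      · have B := bernstein_nonneg (by linarith : 1.6659 < q) (by linarith : q < 1.6671)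
        have e5 : q ^ 5 * c = q ^ 4 * (-q ^ 4 + q ^ 3 + q ^ 2 + 1) - q ^ 3 := by linear_combination q ^ 4 * hs - q ^ 3 * hF
        have e6 : q ^ 6 * c = q ^ 5 * (-q ^ 4 + q ^ 3 + q ^ 2 + 1) - q ^ 4 := by linear_combination q ^ 5 * hs - q ^ 4 * hF
        have l5 : q ^ 5 * c < 1 := by
          rw [e5]
          linarith [B 0 8, B 1 7, B 2 6, B 3 5, B 4 4, B 5 3, B 6 2, B 7 1, B 8 0]
        have l6 : 1 < q ^ 6 * c := by
          rw [e6]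
          linarith [B 0 9, B 1 8, B 2 7, B 3 6, B 4 5, B 5 4, B 6 3, B 7 2, B 8 1, B 9 0]
        exact absurd (hc.1.gap hq l5) (not_le.2 l6)
      · have e : q ^ 2 * c = q * ((q ^ 2 - q - 1) * (q ^ 2 - 1)) + 1 := by
          linear_combination q * hs + hF
        have hc' : 0 < (q ^ 2 - q - 1) * (q ^ 2 - 1) := mul_pos hG (by nlinarith)
        have : 0 < q * ((q ^ 2 - q - 1) * (q ^ 2 - 1)) := by positivity
        have := hc.1.sq_mul_le hq
        linarith
    · obtain ⟨b1, b2⟩ := root_bound_three_five h2 h3 hE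
      have B := bernstein_nonneg (by linarith : 1.6499 < q) (by linarith : q < 1.6511)
      obtain ⟨c, hc, hs⟩ := hb.exists_step h1 hG h3 h3'.le
      rcases hs with ⟨hs, -⟩ | ⟨hs, -⟩ | ⟨-, hs | hs⟩
      · exact two b hb hs
      · exact pow_mul_ne_one_of_le (m := 3) (n := 1) hq hF.le hs
      · have e3 : q ^ 3 * c = q ^ 2 * (-q ^ 4 + q ^ 3 + q ^ 2 + 1) - 1 := by linear_combination q ^ 2 * hs - hF
        have l3 : 1 < q ^ 3 * c := by
          rw [e3]
          linarith [B 0 6, B 1 5, B 2 4, B 3 3, B 4 2, B 5 1, B 6 0]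
        have l2 : q * (q ^ 2 * c) < q := by
          have : q * (q ^ 2 * c) = q ^ 3 * c := by ring
          rw [this, e3]
          linarith [sq_mul_bound h1 hG]
        have := hc.1.le_of_lt hq l3
        nlinarith
      · have e3 : q ^ 3 * c = q ^ 2 * ((q ^ 2 - q - 1) * (q ^ 2 - 1)) + 1 := by
          linear_combination q ^ 2 * hs + hF
        have hc' : 0 < (q ^ 2 - q - 1) * (q ^ 2 - 1) := mul_pos hG (by nlinarith)
        have hc'' : 0 < q ^ 2 * ((q ^ 2 - q - 1) * (q ^ 2 - 1)) := by positivity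
        have l2 : q * (q ^ 2 * c) < q := by
          have : q * (q ^ 2 * c) = q ^ 3 * c := by ring
          rw [this, e3]
          linarith [B 0 6, B 1 5, B 2 4, B 3 3, B 4 2, B 5 1, B 6 0]
        have := hc.1.le_of_lt (m := 2) hq (by rw [e3]; linarith)
        nlinarith
  have big : ∀ a, Occurs q a → ¬1 < q ^ 4 * a := by
    intro a h hc
    rcases h.1.eq_of_one_lt hq hc with h' | h'
    · exact two a h h'
    · exact three a h h'
  have direct : ∀ a a', Occurs q a' → q ^ 5 * a ≤ 1 → ¬q * a' = (-q ^ 4 + q ^ 3 + q ^ 2 + 1) - q ^ 3 * a := by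
    intro a a' ha' h5 hs
    refine big a' ha' ?_
    have e : q ^ 4 * a' = q ^ 3 * (-q ^ 4 + q ^ 3 + q ^ 2 + 1) - q * (q ^ 5 * a) := by linear_combination q ^ 3 * hs
    rw [e]
    nlinarith [mul_neg_of_neg_of_pos h3' (by positivity : 0 < q ^ 2)]
  have reflected : ∀ a, Occurs q a → q ^ 5 * a ≤ 1 →
      ∃ a', Occurs q a' ∧ q * a' = (q ^ 2 - q - 1) * (q ^ 2 - 1) + q ^ 3 * a := by
    intro a h h5
    obtain ⟨a', ha', hs⟩ := h.exists_step h1 hG h3 h3'.le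
    rcases hs with ⟨hs, -⟩ | ⟨hs, -⟩ | ⟨-, hs | hs⟩
    · exact absurd hs (two a h)
    · exact absurd hs (three a h)
    · exact absurd hs (direct a a' ha' h5)
    · exact ⟨a', ha', hs⟩
  have four : ∀ a, Occurs q a → q ^ 4 * a ≠ 1 := by
    intro a h h4a
    obtain ⟨b, hb, hs⟩ := h.exists_step h1 hG h3 h3'.le
    rcases hs with ⟨hs, -⟩ | ⟨hs, -⟩ | ⟨-, hs | hs⟩
    · exact two a h hs
    · exact three a h hs
    · have e4 : q ^ 4 * b = q ^ 3 * (-q ^ 4 + q ^ 3 + q ^ 2 + 1) - q ^ 2 := by linear_combination q ^ 3 * hs - q ^ 2 * h4a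
      have l4 : q ^ 4 * b < 1 := by
        rw [e4]
        nlinarith [mul_pos hp1 (by linarith : 0 < q - 1)]
      obtain ⟨c, hc, hs'⟩ := reflected b hb (hb.1.gap hq l4)
      refine big c hc ?_
      have e : q ^ 4 * c = q ^ 3 * ((q ^ 2 - q - 1) * (q ^ 2 - 1) + (q ^ 2 * (-q ^ 4 + q ^ 3 + q ^ 2 + 1) - q)) := by
        linear_combination q ^ 3 * hs' + q ^ 5 * hs - q ^ 4 * h4a
      rw [e]
      exact poly_bound_four h2 h3
    · have e : q ^ 2 * b = q * ((q ^ 2 - q - 1) * (q ^ 2 - 1)) + 1 := by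
        linear_combination q * hs + h4a
      have hc' : 0 < (q ^ 2 - q - 1) * (q ^ 2 - 1) := mul_pos hG (by nlinarith)
      have : 0 < q * ((q ^ 2 - q - 1) * (q ^ 2 - 1)) := by positivity
      have := hb.1.sq_mul_le hq
      linarith
  have all : ∀ a, Occurs q a → q ^ 5 * a ≤ 1 := fun a h =>
    h.1.gap hq (lt_of_le_of_ne (not_lt.1 (big a h)) (four a h))
  intro h
  obtain ⟨b, hb, hs⟩ := reflected a h (all a h)
  obtain ⟨c, hc, hs'⟩ := reflected b hb (all b hb)
  exact hb.1.not_reflected_twice h1 hG hc.1 (all b hb)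
    (lt_of_reflected h1 hG (h.1.nonneg hq) hs) hs'

lemma countable_expansions_periodic {q : ℝ} (h1 : 1 < q) (hG : 0 < q ^ 2 - q - 1) :
    (expansions q (q / (q ^ 2 - 1))).Countable := by
  have hw : (q ^ 2 - 1) * (1 / (q ^ 2 - 1)) = 1 := mul_one_div_cancel (by nlinarith)
  have hv : q / (q ^ 2 - 1) = q * (1 / (q ^ 2 - 1)) := by ring
  rw [hv]
  have hr : 1 / (q - 1) = (q + 1) * (1 / (q ^ 2 - 1)) := by
    have h2 : q - 1 ≠ 0 := by linarith
    have h3 : q ^ 2 - 1 ≠ 0 := by nlinarith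
    field_simp; ring
  have hp : 0 < 1 / (q ^ 2 - 1) := one_div_pos.2 (by nlinarith)
  set w := 1 / (q ^ 2 - 1)
  refine countable_expansions_of_orbit h1 (X := fun y => y = q * w ∨ y = w) ?_ (Or.inl rfl)
  rintro y (rfl | rfl)
  · refine ⟨1, Or.inr ?_, ?_⟩
    · simp only [Fin.val_one, Nat.cast_one]
      linear_combination hw
    · rw [expansions_eq_empty h1]
      · exact Set.countable_empty
      · right
        rw [hr, rev_digit]
        simp only [Fin.val_one, Nat.cast_one]
        nlinarith
  · refine ⟨0, Or.inl (by simp), ?_⟩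
    rw [expansions_eq_empty h1]
    · exact Set.countable_empty
    · left
      rw [rev_digit]
      simp only [Fin.val_zero, Nat.cast_zero]
      nlinarith

lemma countable_expansions_of_pow_mul {q : ℝ} (h1 : 1 < q) (hG : 0 < q ^ 2 - q - 1) (k : ℕ) {u : ℝ}
    (h : q ^ k * u = q / (q ^ 2 - 1)) : (expansions q u).Countable := by
  induction k generalizing u with
  | zero =>
    rw [pow_zero, one_mul] at h
    rw [h]
    exact countable_expansions_periodic h1 hG
  | succ k ih =>
    have h2 : q ^ k * (q * u) = q / (q ^ 2 - 1) := by rw [← h]; ring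
    rw [countable_expansions_iff h1]
    refine ⟨ih h2, ?_⟩
    rw [expansions_eq_empty h1]
    · exact Set.countable_empty
    · left
      have h3 : q / (q ^ 2 - 1) < 1 := by
        rw [div_lt_one (by nlinarith)]; linarith
      have h4 : 1 ≤ q ^ k := one_le_pow₀ h1.le
      by_contra! hc
      nlinarith

/-- A branching point that returns to itself up to reflection, all side branches being unique
expansions, has exactly countably many expansions. -/
lemma mk_expansions_of_cycle {q a : ℝ} (h1 : 1 < q) (hq2 : q < 2) (hG : 0 < q ^ 2 - q - 1)
    {k n : ℕ} (ha : q ^ k * a = 1) (hl : Lands q a n)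
    (hc : q ^ (n + 1) * (2 + q - q ^ 2 - q * a) = q ^ 2 - 1 + q * a ∨
      q ^ (n + 1) * (2 + q - q ^ 2 - q * a) = q + 1 - q * a) :
    ∃ x ∈ Set.Icc (0 : ℝ) (1 / (q - 1)), Cardinal.mk (expansions q x) = Cardinal.aleph0 := by
  have hw : (q ^ 2 - 1) * (1 / (q ^ 2 - 1)) = 1 := mul_one_div_cancel (by nlinarith)
  have hr : 1 / (q - 1) = (q + 1) * (1 / (q ^ 2 - 1)) := by
    have h2 : q - 1 ≠ 0 := by linarith
    have h3 : q ^ 2 - 1 ≠ 0 := by nlinarith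
    field_simp; ring
  have hf : follow q a = (2 + q - q ^ 2 - q * a) * (1 / (q ^ 2 - 1)) := by rw [follow]; ring
  have hv : q / (q ^ 2 - 1) = q * (1 / (q ^ 2 - 1)) := by ring
  have hr1 := one_lt_inv_sub_one h1 hq2
  have hqr : q * (1 / (q - 1)) = 1 / (q - 1) + 1 := by
    rw [hr]; linear_combination hw
  obtain ⟨s, hs⟩ : ∃ s, q * s = 1 + q * a * (1 / (q ^ 2 - 1)) :=
    ⟨(1 + q * a * (1 / (q ^ 2 - 1))) / q, mul_div_cancel₀ _ (by linarith)⟩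
  have hfs : follow q a = 1 / (q - 1) - q * s := by
    rw [hf, hr, hs]; linear_combination -hw
  have hcyc : q ^ n * follow q a = s ∨ q ^ n * follow q a = 1 / (q - 1) - s := by
    refine hc.imp (fun e => ?_) (fun e => ?_)
    · apply mul_left_cancel₀ (by linarith : q ≠ 0)
      rw [hf, hs]
      linear_combination (1 / (q ^ 2 - 1)) * e + hw
    · apply mul_left_cancel₀ (by linarith : q ≠ 0)
      rw [mul_sub, hqr, hf, hs, hr]
      linear_combination (1 / (q ^ 2 - 1)) * e
  have hsw : s ∈ switch q := by
    rcases hcyc with h | h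
    · rw [← h]; exact hl.2
    · have := reflect_mem_switch h1 hl.2
      rwa [h, sub_sub_cancel] at this
  have hu : q ^ k * (q * s - 1) = q / (q ^ 2 - 1) := by
    rw [hs, hv]; linear_combination q * (1 / (q ^ 2 - 1)) * ha
  have hside := countable_expansions_of_pow_mul h1 hG k hu
  have hcount : (expansions q s).Countable := by
    refine countable_expansions_of_orbit h1
      (X := fun y => ∃ i ≤ n, y = q ^ i * follow q a ∨ y = 1 / (q - 1) - q ^ i * follow q a) ?_ ?_
    · rintro y ⟨i, hi, hy⟩
      rcases hi.lt_or_eq with hi | rfl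
      · have hlt := hl.1 i hi
        rcases hy with rfl | rfl
        · refine ⟨0, ⟨i + 1, hi, Or.inl ?_⟩, ?_⟩
          · simp only [Fin.val_zero, Nat.cast_zero]; ring
          · rw [expansions_eq_empty h1]
            · exact Set.countable_empty
            · left
              rw [rev_digit]
              simp only [Fin.val_zero, Nat.cast_zero]
              linarith
        · refine ⟨1, ⟨i + 1, hi, Or.inr ?_⟩, ?_⟩
          · simp only [Fin.val_one, Nat.cast_one]
            linear_combination hqr
          · rw [expansions_eq_empty h1]
            · exact Set.countable_empty
            · right
              rw [rev_digit]
              simp only [Fin.val_one, Nat.cast_one]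
              linarith
      · have hy' : y = s ∨ y = 1 / (q - 1) - s := by
          rcases hcyc with h | h <;> rw [h] at hy
          · exact hy
          · rw [sub_sub_cancel] at hy; exact hy.symm
        rcases hy' with rfl | rfl
        · refine ⟨0, ⟨0, Nat.zero_le _, Or.inr ?_⟩, ?_⟩
          · simp only [Fin.val_zero, Nat.cast_zero]
            rw [hfs]; ring
          · rw [rev_digit]
            simpa using hside
        · refine ⟨1, ⟨0, Nat.zero_le _, Or.inl ?_⟩, ?_⟩
          · simp only [Fin.val_one, Nat.cast_one]
            rw [hfs]; linear_combination hqr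
          · rw [rev_digit, ← countable_reflect h1]
            convert hside using 2
            simp only [Fin.val_one, Nat.cast_one]
            linear_combination -hqr
    · refine ⟨n, le_rfl, hcyc.imp Eq.symm fun h => ?_⟩
      rw [h]; ring
  have hinf : (expansions q s).Infinite := by
    intro hfin
    have e1 := encard_expansions h1 s
    have e2 : (expansions q (q * s)).encard = (expansions q s).encard := by
      rw [← encard_reflect h1 (q * s), ← hfs, ← hl.encard_eq h1 n le_rfl]
      rcases hcyc with h | h <;> rw [h]
      exact encard_reflect h1 s
    rw [e2] at e1
    have e3 : (expansions q (q * s - 1)).Nonempty :=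
      (expansions_nonempty_iff h1 hq2 _).2 ⟨by linarith [hsw.1], by linarith [hsw.2]⟩
    have e4 : (expansions q (q * s - 1)).encard = 0 := by
      have : (expansions q s).encard + 0 = (expansions q s).encard + (expansions q (q * s - 1)).encard := by
        rw [add_zero]; exact e1
      exact (WithTop.add_left_cancel hfin.encard_lt_top.ne this).symm
    rw [Set.encard_eq_zero] at e4
    exact e3.ne_empty e4
  refine ⟨s, ⟨?_, ?_⟩, ?_⟩
  · have := hsw.1
    by_contra! h
    nlinarith
  · have h2 := hsw.1
    have h3 := hsw.2
    by_contra! h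
    nlinarith
  · have : Countable (expansions q s) := hcount
    have : Infinite (expansions q s) := hinf.to_subtype
    exact Cardinal.mk_eq_aleph0 _

lemma strictMono_first {x y : ℝ} (hx : 1.6 ≤ x) (hxy : x < y) :
    x ^ 6 - x ^ 4 - x ^ 3 - 2 * x ^ 2 - x - 1 < y ^ 6 - y ^ 4 - y ^ 3 - 2 * y ^ 2 - y - 1 := by
  obtain ⟨u, rfl⟩ : ∃ u, x = 1.6 + u := ⟨x - 1.6, by ring⟩
  obtain ⟨v, rfl⟩ : ∃ v, y = 1.6 + v := ⟨y - 1.6, by ring⟩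
  have hu : 0 ≤ u := by linarith
  have huv : u < v := by linarith
  have h := fun n : ℕ => pow_le_pow_left₀ hu huv.le n
  linarith [h 2, h 3, h 4, h 5, h 6]

lemma strictMono_second {x y : ℝ} (hx : 1.6 ≤ x) (hxy : x < y) :
    x ^ 6 - 2 * x ^ 4 - x ^ 3 - 1 < y ^ 6 - 2 * y ^ 4 - y ^ 3 - 1 := by
  obtain ⟨u, rfl⟩ : ∃ u, x = 1.6 + u := ⟨x - 1.6, by ring⟩
  obtain ⟨v, rfl⟩ : ∃ v, y = 1.6 + v := ⟨y - 1.6, by ring⟩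
  have hu : 0 ≤ u := by linarith
  have huv : u < v := by linarith
  have h := fun n : ℕ => pow_le_pow_left₀ hu huv.le n
  linarith [h 2, h 3, h 4, h 5, h 6]

lemma strictMono_third {x y : ℝ} (hx : 1.6 ≤ x) (hxy : x < y) :
    x ^ 5 - x ^ 4 - x ^ 3 - x + 1 < y ^ 5 - y ^ 4 - y ^ 3 - y + 1 := by
  obtain ⟨u, rfl⟩ : ∃ u, x = 1.6 + u := ⟨x - 1.6, by ring⟩
  obtain ⟨v, rfl⟩ : ∃ v, y = 1.6 + v := ⟨y - 1.6, by ring⟩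
  have hu : 0 ≤ u := by linarith
  have huv : u < v := by linarith
  have h := fun n : ℕ => pow_le_pow_left₀ hu huv.le n
  linarith [h 2, h 3, h 4, h 5, h 6]

lemma first_neg {x : ℝ} (h0 : 0 < x) (hx : x ≤ 1.6) : x ^ 6 - x ^ 4 - x ^ 3 - 2 * x ^ 2 - x - 1 < 0 := by
  have h := fun n : ℕ => mul_nonneg (pow_nonneg h0.le n) (by linarith : 0 ≤ 1.6 - x)
  nlinarith [h 0, h 1, h 2, h 3, h 4, h 5]

lemma second_neg {x : ℝ} (h0 : 0 < x) (hx : x ≤ 1.6) : x ^ 6 - 2 * x ^ 4 - x ^ 3 - 1 < 0 := by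
  have h := fun n : ℕ => mul_nonneg (pow_nonneg h0.le n) (by linarith : 0 ≤ 1.6 - x)
  nlinarith [h 0, h 1, h 2, h 3, h 4, h 5, pow_pos h0 3]

lemma third_neg {x : ℝ} (h1 : 1 < x) (hx : x ≤ 1.6) : x ^ 5 - x ^ 4 - x ^ 3 - x + 1 < 0 := by
  have h2 : x ^ 2 - x - 1 < 0 := by nlinarith
  nlinarith [mul_neg_of_neg_of_pos h2 (by positivity : 0 < x ^ 3)]

/-- A function that is negative up to `1.6` and increasing from there on has one positive zero. -/
lemma setOf_root_eq {f : ℝ → ℝ} {l b c : ℝ} (hl : l < 1.6) (hf : Continuous f)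
    (hneg : ∀ x, l < x → x ≤ 1.6 → f x < 0) (hmono : ∀ x y, 1.6 ≤ x → x < y → f x < f y)
    (hb : 1.6 ≤ b) (hbc : b < c) (hfb : f b < 0) (hfc : 0 < f c) :
    ∃ r, b < r ∧ r < c ∧ f r = 0 ∧ {x | l < x ∧ f x = 0} = {r} := by
  obtain ⟨r, ⟨h1, h2⟩, h3⟩ := intermediate_value_Ioo hbc.le hf.continuousOn ⟨hfb, hfc⟩
  refine ⟨r, h1, h2, h3, ?_⟩
  ext x
  constructor
  · rintro ⟨h4, h5⟩
    have h6 : 1.6 < x := by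
      by_contra! hc
      exact (hneg x h4 hc).ne h5
    rcases lt_trichotomy x r with h | h | h
    · exact absurd (hmono x r h6.le h) (by rw [h3, h5]; exact lt_irrefl _)
    · exact h
    · exact absurd (hmono r x (by linarith) h) (by rw [h3, h5]; exact lt_irrefl _)
  · rintro rfl
    exact ⟨by linarith, h3⟩

lemma golden_lt {q : ℝ} (h : (1 + Real.sqrt 5) / 2 < q) : 1.618 < q ∧ 0 < q ^ 2 - q - 1 := by
  have h1 : (2.236 : ℝ) < Real.sqrt 5 := Real.lt_sqrt_of_sq_lt (by norm_num)
  have h2 : Real.sqrt 5 ^ 2 = 5 := Real.sq_sqrt (by norm_num)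
  exact ⟨by linarith, by nlinarith⟩

lemma golden_lt_of_lt {q : ℝ} (h : 1.64 < q) : (1 + Real.sqrt 5) / 2 < q := by
  have h1 : Real.sqrt 5 < 2.24 := (Real.sqrt_lt' (by norm_num)).2 (by norm_num)
  linarith

end QExpansion

open QExpansion in
theorem theorem2 :
    ∃ q₁ q₂ q₃ : ℝ,
      ({x : ℝ | 0 < x ∧ x ^ 6 - x ^ 4 - x ^ 3 - 2 * x ^ 2 - x - 1 = 0} = {q₁} ∧
        |q₁ - 1.64541| < 0.00001) ∧
      ({x : ℝ | 0 < x ∧ x ^ 6 - 2 * x ^ 4 - x ^ 3 - 1 = 0} = {q₂} ∧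
        |q₂ - 1.65462| < 0.00001) ∧
      ({x : ℝ | 1 < x ∧ x ^ 5 - x ^ 4 - x ^ 3 - x + 1 = 0} = {q₃} ∧
        |q₃ - 1.68042| < 0.00001) ∧
      QExpansion.basesWith Cardinal.aleph0 ∩ Set.Ioc ((1 + Real.sqrt 5) / 2) q₃ =
        {q₁, q₂, q₃} := by
  obtain ⟨q₁, a1, b1, e1, s1⟩ := setOf_root_eq
    (f := fun x : ℝ => x ^ 6 - x ^ 4 - x ^ 3 - 2 * x ^ 2 - x - 1) (l := 0) (b := 1.64541)
    (c := 1.645415) (by norm_num) (by fun_prop) (fun x => first_neg) (fun x y => strictMono_first)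
    (by norm_num) (by norm_num) (by norm_num) (by norm_num)
  obtain ⟨q₂, a2, b2, e2, s2⟩ := setOf_root_eq
    (f := fun x : ℝ => x ^ 6 - 2 * x ^ 4 - x ^ 3 - 1) (l := 0) (b := 1.65462)
    (c := 1.654625) (by norm_num) (by fun_prop) (fun x => second_neg) (fun x y => strictMono_second)
    (by norm_num) (by norm_num) (by norm_num) (by norm_num)
  obtain ⟨q₃, a3, b3, e3, s3⟩ := setOf_root_eq
    (f := fun x : ℝ => x ^ 5 - x ^ 4 - x ^ 3 - x + 1) (l := 1) (b := 1.68042)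
    (c := 1.680425) (by norm_num) (by fun_prop) (fun x => third_neg) (fun x y => strictMono_third)
    (by norm_num) (by norm_num) (by norm_num) (by norm_num)
  refine ⟨q₁, q₂, q₃, ⟨s1, abs_lt.2 ⟨by linarith, by linarith⟩⟩,
    ⟨s2, abs_lt.2 ⟨by linarith, by linarith⟩⟩, ⟨s3, abs_lt.2 ⟨by linarith, by linarith⟩⟩, ?_⟩
  ext q
  simp only [Set.mem_inter_iff, Set.mem_Ioc, Set.mem_insert_iff, Set.mem_singleton_iff]
  constructor
  · rintro ⟨⟨⟨-, -⟩, x, -, hx⟩, hq, hq3⟩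
    by_contra! hne
    obtain ⟨n1, n2, n3⟩ := hne
    obtain ⟨g1, g2⟩ := golden_lt hq
    have hq3' : q < q₃ := lt_of_le_of_ne hq3 n3
    have hp3 := strictMono_third (by linarith) hq3'
    rw [e3] at hp3
    have hc : (expansions q x).Countable := Cardinal.le_aleph0_iff_set_countable.1 hx.le
    have hn : (expansions q x).Nontrivial :=
      (Set.infinite_coe_iff.1 (Cardinal.infinite_iff.2 hx.ge)).nontrivial
    obtain ⟨a, ha⟩ := exists_occurs g1 g2 (by linarith) hp3.le hc hn
    rcases lt_or_gt_of_ne n1 with h | h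
    · have hp1 := strictMono_first (by linarith) h
      rw [e1] at hp1
      exact not_occurs_of_low g1 g2 (by linarith) hp3.le hp1 ha
    · have hp1 := strictMono_first (by linarith) h
      rw [e1] at hp1
      refine not_occurs_of_high g1 g2 (by linarith) hp3 hp1 (fun h2 => n2 ?_) ha
      have : q ∈ {x : ℝ | 0 < x ∧ x ^ 6 - 2 * x ^ 4 - x ^ 3 - 1 = 0} := ⟨by linarith, h2⟩
      rwa [s2] at this
  · have mem : ∀ p : ℝ, 1.64 < p → p < 1.6805 →
        (∃ x ∈ Set.Icc (0 : ℝ) (1 / (p - 1)), Cardinal.mk (expansions p x) = Cardinal.aleph0) →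
        p ∈ basesWith Cardinal.aleph0 ∧ (1 + Real.sqrt 5) / 2 < p := fun p h1 h2 h3 =>
      ⟨⟨⟨(golden_lt_of_lt h1).le, by linarith⟩, h3⟩, golden_lt_of_lt h1⟩
    rintro (rfl | rfl | rfl)
    · obtain ⟨g1, g2⟩ := golden_lt (golden_lt_of_lt (by linarith : 1.64 < q))
      have hp3 := strictMono_third (by linarith) (by linarith : q < q₃)
      rw [e3] at hp3
      have ha : q ^ 4 * (1 / q ^ 4) = 1 := mul_one_div_cancel (by positivity)
      obtain ⟨h5, h6⟩ := mem q (by linarith) (by linarith)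
        (mk_expansions_of_cycle (by linarith) (by linarith) g2 ha
          (lands_one g1 g2 hp3.le (by positivity) ha.le) (Or.inl (by
            apply mul_left_cancel₀ (by positivity : q ^ 3 ≠ 0)
            linear_combination (-q ^ 2 - 1) * ha - (q - 1) * e1)))
      exact ⟨h5, h6, by linarith⟩
    · obtain ⟨g1, g2⟩ := golden_lt (golden_lt_of_lt (by linarith : 1.64 < q))
      have ha : q ^ 2 * (1 / q ^ 2) = 1 := mul_one_div_cancel (by positivity)
      obtain ⟨h5, h6⟩ := mem q (by linarith) (by linarith)
        (mk_expansions_of_cycle (by linarith) (by linarith) g2 ha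
          (lands_three g1 g2 (by linarith) ha) (Or.inl (by
            apply mul_left_cancel₀ (by positivity : q ≠ 0)
            linear_combination (-q ^ 4 - 1) * ha - (q - 1) * e2)))
      exact ⟨h5, h6, by linarith⟩
    · obtain ⟨g1, g2⟩ := golden_lt (golden_lt_of_lt (by linarith : 1.64 < q))
      have ha : q ^ 2 * (1 / q ^ 2) = 1 := mul_one_div_cancel (by positivity)
      obtain ⟨h5, h6⟩ := mem q (by linarith) (by linarith)
        (mk_expansions_of_cycle (by linarith) (by linarith) g2 ha
          (lands_three g1 g2 (by linarith) ha) (Or.inr (by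
            apply mul_left_cancel₀ (by positivity : q ≠ 0)
            linear_combination (-q ^ 4 + 1) * ha - (q ^ 2 - 1) * e3)))
      exact ⟨h5, h6, le_rfl⟩
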